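/- Let $\mathbf y_t\in\mathbb R^q$, $t\in\mathbb Z$, be a (second-order) stationary VAR($p$) process $$\mathbf y_t=\boldsymbol\alpha+\boldsymbol\beta\,\mathbf x_t+\boldsymbol\varepsilon_t,\qquad \mathbf x_t=(\mathbf y_{t-1}',\dots,\mathbf y_{t-p}')',\qquad \boldsymbol\beta=(\boldsymbol\beta_1,\dots,\boldsymbol\beta_p)\in\mathbb R^{q\times qp},$$ where the $\boldsymbol\varepsilon_t$ are i.i.d. with mean $\mathbf 0$ and finite positive definite covariance matrix $\boldsymbol\Sigma$, and all roots of $\det(\mathbf I_q-\boldsymbol\beta_1z-\dots-\boldsymbol\beta_pz^p)=0$ are greater than one in modulus. Let $\boldsymbol\Gamma_0=\operatorname{cov}(\mathbf y_t)$, $\mathcal B=\operatorname{span}(\boldsymbol\beta)$, $d=\operatorname{rank}(\boldsymbol\beta)$. A subspace $\mathcal R\subseteq\mathbb R^q$, with orthogonal projection $\mathbf P$ and $\mathbf Q=\mathbf I-\mathbf P$, reduces $\boldsymbol\Sigma$ if $\boldsymbol\Sigma=\mathbf P\boldsymbol\Sigma\mathbf P+\mathbf Q\boldsymbol\Sigma\mathbf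 Q$; the envelope $\mathcal E_{\boldsymbol\Sigma}(\mathcal B)$ is the intersection of all subspaces that reduce $\boldsymbol\Sigma$ and contain $\mathcal B$. Let $u=\dim\mathcal E_{\boldsymbol\Sigma}(\mathcal B)$. Given observations $\mathbf y_{-p+1},\dots,\mathbf y_T$, let $\bar{\mathbf y}=\frac1T\sum_{t=1}^T\mathbf y_t$, $\bar{\mathbf x}=\frac1T\sum_{t=1}^T\mathbf x_t$, and let $\widehat{\boldsymbol\Gamma}_0=\frac1T\sum_{t=1}^T(\mathbf y_t-\bar{\mathbf y})(\mathbf y_t-\bar{\mathbf y})'$, $\widehat{\boldsymbol\Gamma}_{(p)}=\frac1T\sum_{t=1}^T(\mathbf x_t-\bar{\mathbf x})(\mathbf x_t-\bar{\mathbf x})'$, $\widehat{\boldsymbol\Gamma}_*=\frac1T\sum_{t=1}^T(\mathbf x_t-\bar{\mathbf x})(\mathbf y_t-\bar{\mathbf y})'$, and $\widehat{\boldsymbol\Gamma}_{\mathbf y|\mathbf x}=\widehat{\boldsymbol\Gamma}_0-\widehat{\boldsymbol\Gamma}_*'\widehat{\boldsymbol\Gamma}_{(p)}^{-1}\widehat{\boldsymbol\Gamma}_*$.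 For a semiorthogonal matrix $\mathbf D\in\mathbb R^{q\times u}$ ($\mathbf D'\mathbf D=\mathbf I_u$) let $\widehat\omega_1(\mathbf D)\ge\dots\ge\widehat\omega_u(\mathbf D)$ be the eigenvalues of $(\mathbf D'\widehat{\boldsymbol\Gamma}_{\mathbf y|\mathbf x}\mathbf D)^{-1/2}(\mathbf D'\widehat{\boldsymbol\Gamma}_0\mathbf D)(\mathbf D'\widehat{\boldsymbol\Gamma}_{\mathbf y|\mathbf x}\mathbf D)^{-1/2}$, and set $$\mathbf F_T(\mathbf D|p,d,u)=\log|\mathbf D'\widehat{\boldsymbol\Gamma}_{\mathbf y|\mathbf x}\mathbf D|+\log|\mathbf D'\widehat{\boldsymbol\Gamma}_0^{-1}\mathbf D|+\sum_{i=d+1}^u\log\widehat\omega_i(\mathbf D),\qquad \mathbf F(\mathbf D)=\log|\mathbf D'\boldsymbol\Sigma\mathbf D|+\log|\mathbf D'\boldsymbol\Gamma_0^{-1}\mathbf D|.$$ Then, as $T\to\infty$: 1. $\sup_{\mathbf D}|\mathbf F_T(\mathbf D|p,d,u)-\mathbf F(\mathbf D)|\to0$ in probability, the supremum being over all semiorthogonal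 $\mathbf D\in\mathbb R^{q\times u}$. 2. With probability tending to one $\mathbf F_T(\cdot|p,d,u)$ has a minimizer over the semiorthogonal matrices, and any estimator $\widehat{\boldsymbol\Phi}=\widehat{\boldsymbol\Phi}_T$ which is such a minimizer whenever one exists is consistent: for every semiorthogonal $\boldsymbol\Phi$ with $\operatorname{span}(\boldsymbol\Phi)=\mathcal E_{\boldsymbol\Sigma}(\mathcal B)$, the distance from $\widehat{\boldsymbol\Phi}_T$ to $\{\boldsymbol\Phi\mathbf O:\mathbf O\in\mathbb R^{u\times u}\text{ orthogonal}\}$ tends to $0$ in probability. 3. $\widehat{\mathcal E}_{\boldsymbol\Sigma}(\mathcal B)=\operatorname{span}(\widehat{\boldsymbol\Phi}_T)$ is a consistent estimator of $\mathcal E_{\boldsymbol\Sigma}(\mathcal B)$: the orthogonal projection onto $\operatorname{span}(\widehat{\boldsymbol\Phi}_T)$ converges in probability to the orthogonal projection onto $\mathcal E_{\boldsymbol\Sigma}(\mathcal B)$. (Here outer probability is meant for events that may fail to be measurable.) -/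

import Mathlib

open MeasureTheory ProbabilityTheory Filter Topology

noncomputable section

namespace REVAR

/-! Subspaces of `ℝ^q`, reducing subspaces and envelopes -/

/-- The span of the columns of a matrix with `q` rows, as a subspace of Euclidean space. -/
def colSpan {q : ℕ} {n : Type*} (M : Matrix (Fin q) n ℝ) :
    Submodule ℝ (EuclideanSpace ℝ (Fin q)) :=
  Submodule.span ℝ (Set.range fun j : n => WithLp.toLp 2 (fun i => M i j))

/-- `R` reduces `M`: `M = P M P + Q M Q`, where `P` is the orthogonal projection onto `R` and
`Q = 1 - P`. -/
def Reduces {q : ℕ} (R : Submodule ℝ (EuclideanSpace ℝ (Fin q)))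
    (M : Matrix (Fin q) (Fin q) ℝ) : Prop :=
  Matrix.toEuclideanCLM (n := Fin q) (𝕜 := ℝ) M =
    R.starProjection * Matrix.toEuclideanCLM (n := Fin q) (𝕜 := ℝ) M * R.starProjection +
      (1 - R.starProjection) * Matrix.toEuclideanCLM (n := Fin q) (𝕜 := ℝ) M *
        (1 - R.starProjection)

/-- The `M`-envelope of `S`: the intersection of all reducing subspaces of `M` containing `S`. -/
def envelope {q : ℕ} (M : Matrix (Fin q) (Fin q) ℝ)
    (S : Submodule ℝ (EuclideanSpace ℝ (Fin q))) : Submodule ℝ (EuclideanSpace ℝ (Fin q)) :=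
  sInf {R | Reduces R M ∧ S ≤ R}

/-! The vector autoregression -/

/-- The lagged vector `x_t = (y_{t-1}', …, y_{t-p}')'`; the coordinate `(k, j)` is the `j`-th
coordinate of `y_{t-1-k}`, for `k = 0, …, p - 1`. -/
def lagVec {q : ℕ} (p : ℕ) (y : ℤ → Fin q → ℝ) (t : ℤ) : Fin p × Fin q → ℝ :=
  fun kj => y (t - 1 - (kj.1 : ℤ)) kj.2

/-- The characteristic polynomial matrix `I - β₁ z - … - β_p z^p`, where
`β = (β₁, …, β_p)` is a `q × qp` matrix in block form. -/
def charMatrix {p q : ℕ} (β : Matrix (Fin q) (Fin p × Fin q) ℝ) (z : ℂ) :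
    Matrix (Fin q) (Fin q) ℂ :=
  1 - ∑ k : Fin p, z ^ ((k : ℕ) + 1) • Matrix.of fun i j => ((β i (k, j) : ℝ) : ℂ)

/-- The covariance matrix of two random vectors. -/
def covMatrix {Ω : Type*} [MeasurableSpace Ω] (P : Measure Ω) {m n : Type*}
    (X : Ω → m → ℝ) (Y : Ω → n → ℝ) : Matrix m n ℝ :=
  Matrix.of fun i j => covariance (fun ω => X ω i) (fun ω => Y ω j) P

/-- Independent identically distributed noise with mean zero and (finite) covariance `Sigma`. -/
structure IsIIDNoise {Ω : Type*} [MeasurableSpace Ω] (P : Measure Ω) {q : ℕ}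
    (Sigma : Matrix (Fin q) (Fin q) ℝ) (ε : ℤ → Ω → Fin q → ℝ) : Prop where
  indep : iIndepFun ε P
  identDistrib : ∀ t, IdentDistrib (ε t) (ε 0) P P
  memLp : ∀ t i, MemLp (fun ω => ε t ω i) 2 P
  mean_zero : ∀ t i, ∫ ω, ε t ω i ∂P = 0
  cov_eq : ∀ t, covMatrix P (ε t) (ε t) = Sigma

/-- A (second-order) stationary vector process. -/
structure IsStationary {Ω : Type*} [MeasurableSpace Ω] (P : Measure Ω) {q : ℕ}
    (y : ℤ → Ω → Fin q → ℝ) : Prop where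
  memLp : ∀ t i, MemLp (fun ω => y t ω i) 2 P
  mean_eq : ∀ t i, ∫ ω, y t ω i ∂P = ∫ ω, y 0 ω i ∂P
  cov_eq : ∀ s t h, covMatrix P (y (s + h)) (y (t + h)) = covMatrix P (y s) (y t)

/-- `y` is a stationary VAR(`p`) process `y_t = α + β x_t + ε_t` driven by i.i.d. noise with
covariance matrix `Sigma`, all roots of `det (I - β₁ z - … - β_p z^p)` being greater than one in
modulus. -/
structure IsStationaryVAR {Ω : Type*} [MeasurableSpace Ω] (P : Measure Ω) {p q : ℕ}
    (α : Fin q → ℝ) (β : Matrix (Fin q) (Fin p × Fin q) ℝ) (Sigma : Matrix (Fin q) (Fin q) ℝ)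
    (ε y : ℤ → Ω → Fin q → ℝ) : Prop where
  noise : IsIIDNoise P Sigma ε
  stationary : IsStationary P y
  roots : ∀ z : ℂ, (charMatrix β z).det = 0 → 1 < ‖z‖
  equation : ∀ t, ∀ᵐ ω ∂P,
    y t ω = α + β.mulVec (lagVec p (fun s => y s ω) t) + ε t ω

/-! Sample moments of a path, computed from the time points `1, …, T` -/

/-- The sample mean `T⁻¹ ∑_{t=1}^T v_t`. -/
def sampleMean {n : Type*} (T : ℕ) (v : ℤ → n → ℝ) : n → ℝ :=
  (T : ℝ)⁻¹ • ∑ t ∈ Finset.Icc (1 : ℤ) (T : ℤ), v t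

/-- The sample cross-covariance matrix `T⁻¹ ∑_{t=1}^T (v_t - v̄)(w_t - w̄)'`. -/
def sampleCov {m n : Type*} (T : ℕ) (v : ℤ → m → ℝ) (w : ℤ → n → ℝ) : Matrix m n ℝ :=
  (T : ℝ)⁻¹ • ∑ t ∈ Finset.Icc (1 : ℤ) (T : ℤ),
    Matrix.vecMulVec (v t - sampleMean T v) (w t - sampleMean T w)

/-- The sample covariance matrix of the residuals of the autoregression of `y_t` on `x_t`,
`Γ̂₀ - Γ̂_*' Γ̂_(p)⁻¹ Γ̂_*`. -/
def residCov {q : ℕ} (p T : ℕ) (y : ℤ → Fin q → ℝ) : Matrix (Fin q) (Fin q) ℝ :=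
  sampleCov T y y -
    (sampleCov T (lagVec p y) y).transpose *
      (sampleCov T (lagVec p y) (lagVec p y))⁻¹ * sampleCov T (lagVec p y) y

theorem sampleCov_transpose {m n : Type*} (T : ℕ) (v : ℤ → m → ℝ) (w : ℤ → n → ℝ) :
    (sampleCov T v w).transpose = sampleCov T w v := by
  simp [sampleCov, Matrix.transpose_sum, Matrix.transpose_vecMulVec]

/-! The objective functions -/

/-- The inverse square root of a symmetric positive definite matrix. -/
def invSqrt {u : ℕ} (S : Matrix (Fin u) (Fin u) ℝ) : Matrix (Fin u) (Fin u) ℝ :=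
  cfc (fun x : ℝ => (Real.sqrt x)⁻¹) S

theorem isHermitian_invSqrt_mul {u : ℕ} (S G : Matrix (Fin u) (Fin u) ℝ)
    (hG : G.IsHermitian) : (invSqrt S * G * invSqrt S).IsHermitian := by
  have hR : (invSqrt S).IsHermitian := (cfc_predicate (p := IsSelfAdjoint) _ S : IsSelfAdjoint _)
  have h := Matrix.isHermitian_conjTranspose_mul_mul (invSqrt S) hG
  rwa [hR.eq] at h

theorem isHermitian_compress {q u : ℕ} (T : ℕ) (y : ℤ → Fin q → ℝ)
    (D : Matrix (Fin q) (Fin u) ℝ) :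
    (D.transpose * sampleCov T y y * D).IsHermitian := by
  rw [Matrix.IsHermitian, Matrix.conjTranspose_eq_transpose_of_trivial]
  simp [Matrix.transpose_mul, sampleCov_transpose, Matrix.mul_assoc]

/-- The eigenvalues `ω̂₁(D) ≥ … ≥ ω̂_u(D)` of
`(D'Γ̂_{y|x}D)^{-1/2} (D'Γ̂₀D) (D'Γ̂_{y|x}D)^{-1/2}` in decreasing order
(numbered from `0` to `u - 1`). -/
def omegaHat {q u : ℕ} (p T : ℕ) (y : ℤ → Fin q → ℝ) (D : Matrix (Fin q) (Fin u) ℝ) :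
    Fin (Fintype.card (Fin u)) → ℝ :=
  (isHermitian_invSqrt_mul (D.transpose * residCov p T y * D) (D.transpose * sampleCov T y y * D)
    (isHermitian_compress T y D)).eigenvalues₀

/-- The sample objective function
`F_T(D | p, d, u) = log |D'Γ̂_{y|x}D| + log |D'Γ̂₀⁻¹D| + ∑_{i=d+1}^u log ω̂_i(D)`. -/
def sampleObjective {q u : ℕ} (p d T : ℕ) (y : ℤ → Fin q → ℝ) (D : Matrix (Fin q) (Fin u) ℝ) : ℝ :=
  Real.log (D.transpose * residCov p T y * D).det +
    Real.log (D.transpose * (sampleCov T y y)⁻¹ * D).det +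
    ∑ i : Fin (Fintype.card (Fin u)) with d ≤ i.val, Real.log (omegaHat p T y D i)

/-- The population objective function `F(D) = log |D'ΣD| + log |D'Γ₀⁻¹D|`. -/
def popObjective {q u : ℕ} (Sigma Gamma0 : Matrix (Fin q) (Fin q) ℝ)
    (D : Matrix (Fin q) (Fin u) ℝ) : ℝ :=
  Real.log (D.transpose * Sigma * D).det + Real.log (D.transpose * Gamma0⁻¹ * D).det

/-- Semiorthogonal `q × u` matrices: `D'D = I_u`. -/
def IsSemiorthogonal {q u : ℕ} (D : Matrix (Fin q) (Fin u) ℝ) : Prop :=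
  D.transpose * D = 1

/-- `D` minimizes `F` over the semiorthogonal matrices. -/
def IsArgmin {q u : ℕ} (F : Matrix (Fin q) (Fin u) ℝ → ℝ) (D : Matrix (Fin q) (Fin u) ℝ) : Prop :=
  IsSemiorthogonal D ∧ ∀ D', IsSemiorthogonal D' → F D ≤ F D'

end REVAR

end

namespace REVAR

open scoped ENNReal Matrix

/-! Quadratic forms and eigenvalues -/

section Quadratic

variable {n : Type*} [Fintype n]

/-! Everything rests on the identity Γ₀ = Σ + β Γ_(p) β' with Γ_(p) positive definite
(`IsStationaryVAR.covMatrix_eq`, `IsStationaryVAR.posDef_lagCov`).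

Limit of the objective. For semiorthogonal D the forms D'ΣD and D'Γ₀D agree on the kernel of β'D,
which has codimension at most d, so by min-max all but the d largest eigenvalues of the population
pencil equal 1 (`pencilEigenvalues_eq_one`). Hence the sum of logarithms in F_T vanishes at the
population moments, and F is the same functional as F_T with sample moments replaced by their
limits. That functional is Lipschitz for multiplicative closeness of quadratic forms
(`abs_coreObjective_sub_le`). Compression by D preserves this closeness with the same constant, so
consistency of the moments already gives uniform convergence in D.

Minimizers of F. Let C complete D to an orthogonal matrix. Jacobi's identity for complementary
minors turns F(D) into log|Σ| - log|Γ₀| plus the gap between log|C'Γ₀C| and log|(C'Σ⁻¹C)⁻¹|. The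
difference of these two matrices is a sum of two positive semidefinite terms
(`complement_form_sub`), one vanishing exactly when span(D) reduces Σ, the other exactly when
span(D) contains span(β). So a minimizer spans a reducing subspace containing span(β). It has the
dimension of the envelope, hence equals it. Compactness of the set of semiorthogonal matrices
transfers this to minimizers of F_T.

Moments. Iterating the state equation, whose companion matrix has powers tending to zero, exhibits
each coordinate of y as an L² limit, uniform in time, of finite moving averages of the noise.
Products of such averages obey an L¹ law of large numbers: equal lags by the strong law, distinct
lags by orthogonality. Second moments suffice throughout (`IsMALimit.meanErgodic_mul`). -/

theorem dotProduct_mulVec_compress {m : Type*} [Fintype m] (A : Matrix m m ℝ) (D : Matrix m n ℝ)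
    (x : n → ℝ) : x ⬝ᵥ (Dᵀ * A * D) *ᵥ x = (D *ᵥ x) ⬝ᵥ A *ᵥ (D *ᵥ x) := by
  rw [← Matrix.mulVec_mulVec, ← Matrix.mulVec_mulVec, Matrix.dotProduct_mulVec,
    Matrix.vecMul_transpose]

theorem dotProduct_diagonal_mulVec [DecidableEq n] (d x : n → ℝ) :
    x ⬝ᵥ Matrix.diagonal d *ᵥ x = ∑ i, d i * x i ^ 2 := by
  simp only [dotProduct, Matrix.mulVec_diagonal]
  exact Finset.sum_congr rfl fun i _ => by ring

theorem dotProduct_self_eq_sum_sq (x : n → ℝ) : x ⬝ᵥ x = ∑ i, x i ^ 2 :=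
  Finset.sum_congr rfl fun i _ => by ring

variable [DecidableEq n]

/-- Diagonalization of a real symmetric matrix. -/
theorem exists_orthogonal_diagonalization {A : Matrix n n ℝ} (hA : A.IsHermitian) :
    ∃ U : Matrix n n ℝ, Uᵀ * U = 1 ∧ U * Uᵀ = 1 ∧
      A = U * Matrix.diagonal hA.eigenvalues * Uᵀ := by
  refine ⟨hA.eigenvectorUnitary, ?_, ?_, ?_⟩
  · exact Unitary.coe_star_mul_self hA.eigenvectorUnitary
  · exact Unitary.coe_mul_star_self hA.eigenvectorUnitary
  · exact hA.spectral_theorem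

/-- Here `U` sends a vector to its coordinates in an orthonormal eigenbasis, so every min-max
argument below becomes a comparison of weighted sums of squares. -/
theorem exists_coordinates {A : Matrix n n ℝ} (hA : A.IsHermitian) :
    ∃ U : Matrix n n ℝ, (∀ x : n → ℝ, x ⬝ᵥ x = ∑ j, (U *ᵥ x) j ^ 2) ∧
      ∀ x : n → ℝ, x ⬝ᵥ A *ᵥ x = ∑ j, hA.eigenvalues j * (U *ᵥ x) j ^ 2 := by
  obtain ⟨U, -, h2, h3⟩ := exists_orthogonal_diagonalization hA
  refine ⟨Uᵀ, fun x => ?_, fun x => ?_⟩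
  · rw [← dotProduct_self_eq_sum_sq, Matrix.dotProduct_mulVec, Matrix.vecMul_transpose,
      Matrix.mulVec_mulVec, h2, Matrix.one_mulVec]
  · have := dotProduct_mulVec_compress (Matrix.diagonal hA.eigenvalues) Uᵀ x
    rw [Matrix.transpose_transpose, ← h3] at this
    rw [this, dotProduct_diagonal_mulVec]

/-- The sorted eigenvalues are bounded above by the quadratic form on large subspaces. -/
theorem eigenvalues₀_le_of_forall_mem {A : Matrix n n ℝ} (hA : A.IsHermitian)
    (i : Fin (Fintype.card n)) (W : Submodule ℝ (n → ℝ)) {c : ℝ}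
    (hdim : Fintype.card n ≤ Module.finrank ℝ W + i)
    (hW : ∀ x ∈ W, x ⬝ᵥ A *ᵥ x ≤ c * (x ⬝ᵥ x)) : hA.eigenvalues₀ i ≤ c := by
  classical
  obtain ⟨U, hU1, hU2⟩ := exists_coordinates hA
  let e : n ≃ Fin (Fintype.card n) := (Fintype.equivOfCardEq (Fintype.card_fin _)).symm
  have he : ∀ j, hA.eigenvalues j = hA.eigenvalues₀ (e j) := fun j => rfl
  -- Courant-Fischer: `f` reads the `card n - 1 - i` eigencoordinates beyond `i`, fewer than the
  -- dimension of `W`. So `W` contains a nonzero combination of the eigenvectors with index at most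
  -- `i`.
  let f : W →ₗ[ℝ] ({k : Fin (Fintype.card n) // i < k} → ℝ) :=
    LinearMap.pi fun k => (LinearMap.proj (e.symm k.1)) ∘ₗ U.mulVecLin ∘ₗ W.subtype
  have hker : LinearMap.ker f ≠ ⊥ := by
    apply LinearMap.ker_ne_bot_of_finrank_lt
    have : Fintype.card {k : Fin (Fintype.card n) // i < k} = Fintype.card n - 1 - i := by
      rw [Fintype.card_subtype]
      have : (Finset.univ.filter fun k => i < k) = Finset.Ioi i := by ext; simp
      rw [this, Fin.card_Ioi]
    rw [Module.finrank_fintype_fun_eq_card, this]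
    have := i.2
    omega
  obtain ⟨⟨x, hxW⟩, hxk, hx0⟩ := Submodule.exists_mem_ne_zero_of_ne_bot hker
  have hx0' : x ≠ 0 := fun h => hx0 (Subtype.ext h)
  have hz : ∀ j, i < e j → (U *ᵥ x) j = 0 := fun j hj => by
    have := congrFun (LinearMap.mem_ker.1 hxk) ⟨e j, hj⟩
    simpa [f] using this
  have hpos : 0 < x ⬝ᵥ x := by
    have := Matrix.dotProduct_star_self_pos_iff.2 hx0'
    simpa using this
  have h1 : hA.eigenvalues₀ i * (x ⬝ᵥ x) ≤ x ⬝ᵥ A *ᵥ x := by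
    rw [hU1, hU2, Finset.mul_sum]
    refine Finset.sum_le_sum fun j _ => ?_
    by_cases hj : i < e j
    · simp [hz j hj]
    · rw [he]
      exact mul_le_mul_of_nonneg_right (hA.eigenvalues₀_antitone (not_lt.1 hj)) (sq_nonneg _)
  exact le_of_mul_le_mul_right (h1.trans (hW x hxW)) hpos

/-- The bound in `eigenvalues₀_le_of_forall_mem` is attained. -/
theorem exists_subspace_forall_mem_le {A : Matrix n n ℝ} (hA : A.IsHermitian)
    (i : Fin (Fintype.card n)) : ∃ W : Submodule ℝ (n → ℝ),
      Fintype.card n ≤ Module.finrank ℝ W + i ∧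
      ∀ x ∈ W, x ⬝ᵥ A *ᵥ x ≤ hA.eigenvalues₀ i * (x ⬝ᵥ x) := by
  classical
  obtain ⟨U, hU1, hU2⟩ := exists_coordinates hA
  let e : n ≃ Fin (Fintype.card n) := (Fintype.equivOfCardEq (Fintype.card_fin _)).symm
  have he : ∀ j, hA.eigenvalues j = hA.eigenvalues₀ (e j) := fun j => rfl
  -- The extremal subspace is spanned by the eigenvectors with index at least `i`, written as the
  -- kernel of the `i` preceding coordinates.
  let f : (n → ℝ) →ₗ[ℝ] ({k : Fin (Fintype.card n) // k < i} → ℝ) :=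
    LinearMap.pi fun k => (LinearMap.proj (e.symm k.1)) ∘ₗ U.mulVecLin
  refine ⟨LinearMap.ker f, ?_, fun x hx => ?_⟩
  · have h1 := f.finrank_range_add_finrank_ker
    have h2 := Submodule.finrank_le (LinearMap.range f)
    have : Fintype.card {k : Fin (Fintype.card n) // k < i} = i := by
      rw [Fintype.card_subtype]
      have : (Finset.univ.filter fun k => k < i) = Finset.Iio i := by ext; simp
      rw [this, Fin.card_Iio]
    rw [Module.finrank_fintype_fun_eq_card] at h1 h2
    omega
  · have hz : ∀ j, e j < i → (U *ᵥ x) j = 0 := fun j hj => by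
      have := congrFun (LinearMap.mem_ker.1 hx) ⟨e j, hj⟩
      simpa [f] using this
    rw [hU1, hU2, Finset.mul_sum]
    refine Finset.sum_le_sum fun j _ => ?_
    by_cases hj : e j < i
    · simp [hz j hj]
    · rw [he]
      exact mul_le_mul_of_nonneg_right (hA.eigenvalues₀_antitone (not_lt.1 hj)) (sq_nonneg _)

theorem le_eigenvalues₀ {A : Matrix n n ℝ} (hA : A.IsHermitian) {c : ℝ}
    (h : ∀ x : n → ℝ, c * (x ⬝ᵥ x) ≤ x ⬝ᵥ A *ᵥ x) (i : Fin (Fintype.card n)) :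
    c ≤ hA.eigenvalues₀ i := by
  obtain ⟨W, hW, hle⟩ := exists_subspace_forall_mem_le hA i
  have hne : W ≠ ⊥ := by
    rintro rfl
    have := i.2
    rw [finrank_bot] at hW
    omega
  obtain ⟨x, hxW, hx0⟩ := Submodule.exists_mem_ne_zero_of_ne_bot hne
  have hpos : 0 < x ⬝ᵥ x := by
    have := Matrix.dotProduct_star_self_pos_iff.2 hx0
    simpa using this
  exact le_of_mul_le_mul_right ((h x).trans (hle x hxW)) hpos

theorem det_eq_prod_eigenvalues₀ {A : Matrix n n ℝ} (hA : A.IsHermitian) :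
    A.det = ∏ i, hA.eigenvalues₀ i := by
  rw [hA.det_eq_prod_eigenvalues]
  exact Fintype.prod_equiv (Fintype.equivOfCardEq (Fintype.card_fin _)).symm _ _ fun j => rfl

/-- A positive definite quadratic form dominates a multiple of the squared norm. -/
theorem exists_dotProduct_self_le {M : Matrix n n ℝ} (hM : M.PosDef) :
    ∃ C > 0, ∀ x : n → ℝ, x ⬝ᵥ x ≤ C * (x ⬝ᵥ M *ᵥ x) := by
  obtain ⟨U, hU1, hU2⟩ := exists_coordinates hM.1
  -- The sum dominates each reciprocal eigenvalue; the added 1 keeps the constant positive when the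
  -- index type is empty.
  refine ⟨∑ j, (hM.1.eigenvalues j)⁻¹ + 1, ?_, fun x => ?_⟩
  · have : 0 ≤ ∑ j, (hM.1.eigenvalues j)⁻¹ :=
      Finset.sum_nonneg fun j _ => (inv_pos.2 (hM.eigenvalues_pos j)).le
    linarith
  · rw [hU1, hU2, Finset.mul_sum]
    refine Finset.sum_le_sum fun j _ => ?_
    have hj := hM.eigenvalues_pos j
    have h1 : (hM.1.eigenvalues j)⁻¹ ≤ ∑ j, (hM.1.eigenvalues j)⁻¹ + 1 := by
      have := Finset.single_le_sum (f := fun j => (hM.1.eigenvalues j)⁻¹)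
        (fun j _ => (inv_pos.2 (hM.eigenvalues_pos j)).le) (Finset.mem_univ j)
      linarith
    rw [← mul_assoc]
    have h2 : 1 ≤ (∑ j, (hM.1.eigenvalues j)⁻¹ + 1) * hM.1.eigenvalues j := by
      have := mul_le_mul_of_nonneg_right h1 hj.le
      rwa [inv_mul_cancel₀ hj.ne'] at this
    nlinarith [sq_nonneg ((U *ᵥ x) j)]

theorem posDef_compress {m : Type*} [Fintype m] {M : Matrix m m ℝ} (hM : M.PosDef)
    {D : Matrix m n ℝ} (hD : Dᵀ * D = 1) : (Dᵀ * M * D).PosDef := by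
  have := hM.conjTranspose_mul_mul_same (B := D) (by
    intro x y hxy
    have := congrArg (Dᵀ *ᵥ ·) hxy
    simpa [hD] using this)
  simpa using this

end Quadratic

/-! Multiplicative closeness of quadratic forms -/

/-- The quadratic forms of `M` and `N` agree up to the factor `exp η`. -/
def LoewnerClose {n : Type*} [Fintype n] (η : ℝ) (M N : Matrix n n ℝ) : Prop :=
  ∀ x : n → ℝ, x ⬝ᵥ N *ᵥ x ≤ Real.exp η * (x ⬝ᵥ M *ᵥ x) ∧
    x ⬝ᵥ M *ᵥ x ≤ Real.exp η * (x ⬝ᵥ N *ᵥ x)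

namespace LoewnerClose

variable {n : Type*} [Fintype n] {η : ℝ} {M N : Matrix n n ℝ}

theorem symm (h : LoewnerClose η M N) : LoewnerClose η N M := fun x => ⟨(h x).2, (h x).1⟩

/-- The form of D'MD at x is that of M at Dx. The same `η` therefore serves all D at once, which is
the source of uniformity in D. -/
theorem compress {m : Type*} [Fintype m] (h : LoewnerClose η M N) (D : Matrix n m ℝ) :
    LoewnerClose η (Dᵀ * M * D) (Dᵀ * N * D) := fun x => by
  simpa only [dotProduct_mulVec_compress] using h (D *ᵥ x)

theorem posDef (h : LoewnerClose η M N) (hM : M.PosDef) (hN : N.IsHermitian) : N.PosDef := by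
  refine Matrix.PosDef.of_dotProduct_mulVec_pos hN fun x hx => ?_
  have h1 := hM.dotProduct_mulVec_pos hx
  rw [star_trivial] at h1 ⊢
  have h2 := (h x).2
  exact pos_of_mul_pos_right (h1.trans_le h2) (Real.exp_pos η).le

end LoewnerClose

/-- The sum of the absolute entries of N - M bounds the change of the form relative to x'x, and x'x
is at most `C` times x'Mx. A relative error below 1 - exp(-η) gives the lower factor exp(-η), and
also the upper factor exp η because exp η + exp(-η) is at least 2. -/
theorem eventually_loewnerClose {n : Type*} [Fintype n] {M : Matrix n n ℝ} (hM : M.PosDef)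
    {η : ℝ} (hη : 0 < η) : ∀ᶠ N in 𝓝 M, LoewnerClose η M N := by
  classical
  obtain ⟨C, hC, hCle⟩ := exists_dotProduct_self_le hM
  have hexp : 0 < 1 - Real.exp (-η) := by
    have := Real.exp_lt_one_iff.2 (neg_lt_zero.2 hη); linarith
  have hcont : Continuous fun N : Matrix n n ℝ => ∑ i, ∑ j, |(N - M) i j| := by fun_prop
  have hev : ∀ᶠ N in 𝓝 M, ∑ i, ∑ j, |(N - M) i j| < (1 - Real.exp (-η)) / C := by
    refine hcont.continuousAt.eventually_lt_const ?_
    simpa using by positivity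
  filter_upwards [hev] with N hN x
  have hdiff : |x ⬝ᵥ N *ᵥ x - x ⬝ᵥ M *ᵥ x| ≤ (1 - Real.exp (-η)) * (x ⬝ᵥ M *ᵥ x) := by
    rw [← dotProduct_sub, ← Matrix.sub_mulVec]
    have hxx : 0 ≤ x ⬝ᵥ x := by rw [dotProduct_self_eq_sum_sq]; positivity
    have hco : ∀ i, x i ^ 2 ≤ x ⬝ᵥ x := fun i => by
      rw [dotProduct_self_eq_sum_sq]
      exact Finset.single_le_sum (f := fun i => x i ^ 2) (fun i _ => sq_nonneg _)
        (Finset.mem_univ i)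
    have hprod : ∀ i j, |x i| * |x j| ≤ x ⬝ᵥ x := fun i j => by
      nlinarith [hco i, hco j, sq_nonneg (|x i| - |x j|), sq_abs (x i), sq_abs (x j)]
    calc |x ⬝ᵥ (N - M) *ᵥ x| = |∑ i, ∑ j, x i * ((N - M) i j * x j)| := by
          simp only [dotProduct, Matrix.mulVec, Finset.mul_sum]
      _ ≤ ∑ i, ∑ j, |x i * ((N - M) i j * x j)| :=
          (Finset.abs_sum_le_sum_abs _ _).trans
            (Finset.sum_le_sum fun i _ => Finset.abs_sum_le_sum_abs _ _)
      _ ≤ ∑ i, ∑ j, |(N - M) i j| * (x ⬝ᵥ x) := by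
          refine Finset.sum_le_sum fun i _ => Finset.sum_le_sum fun j _ => ?_
          rw [abs_mul, abs_mul]
          nlinarith [hprod i j, abs_nonneg ((N - M) i j)]
      _ = (∑ i, ∑ j, |(N - M) i j|) * (x ⬝ᵥ x) := by simp only [Finset.sum_mul]
      _ ≤ (1 - Real.exp (-η)) / C * (C * (x ⬝ᵥ M *ᵥ x)) :=
          mul_le_mul hN.le (hCle x) hxx (by positivity)
      _ = (1 - Real.exp (-η)) * (x ⬝ᵥ M *ᵥ x) := by field_simp
  have hMx : 0 ≤ x ⬝ᵥ M *ᵥ x := by simpa using hM.posSemidef.dotProduct_mulVec_nonneg x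
  obtain ⟨h1, h2⟩ := abs_le.1 hdiff
  have he : Real.exp η * Real.exp (-η) = 1 := by rw [← Real.exp_add]; simp
  have hη1 : 1 < Real.exp η := Real.one_lt_exp_iff.2 hη
  constructor
  · have : 1 - Real.exp (-η) ≤ Real.exp η - 1 := by
      nlinarith [sq_nonneg (Real.exp η - 1), Real.exp_pos (-η)]
    nlinarith
  · have : Real.exp (-η) * (x ⬝ᵥ M *ᵥ x) ≤ x ⬝ᵥ N *ᵥ x := by linarith
    calc x ⬝ᵥ M *ᵥ x = Real.exp η * (Real.exp (-η) * (x ⬝ᵥ M *ᵥ x)) := by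
          rw [← mul_assoc, he, one_mul]
      _ ≤ _ := mul_le_mul_of_nonneg_left this (Real.exp_pos η).le

/-! Eigenvalues of a pencil -/

section Pencil

variable {u : ℕ} {M G : Matrix (Fin u) (Fin u) ℝ}

theorem invSqrt_transpose (M : Matrix (Fin u) (Fin u) ℝ) : (invSqrt M)ᵀ = invSqrt M := by
  have hR : (invSqrt M).IsHermitian := (cfc_predicate (p := IsSelfAdjoint) _ M : IsSelfAdjoint _)
  simpa using hR.eq

theorem invSqrt_mul_mul_invSqrt (hM : M.PosDef) : invSqrt M * M * invSqrt M = 1 := by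
  have hsa : IsSelfAdjoint M := hM.1
  have hpos : ∀ x ∈ spectrum ℝ M, 0 < x := by
    intro x hx
    rw [hM.1.spectrum_real_eq_range_eigenvalues] at hx
    obtain ⟨i, rfl⟩ := hx
    exact hM.eigenvalues_pos i
  have hc : ContinuousOn (fun x : ℝ => (Real.sqrt x)⁻¹) (spectrum ℝ M) :=
    Real.continuous_sqrt.continuousOn.inv₀ fun x hx => (Real.sqrt_pos.2 (hpos x hx)).ne'
  have hid : ContinuousOn (fun x : ℝ => x) (spectrum ℝ M) := continuousOn_id
  calc invSqrt M * M * invSqrt M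
      = cfc (fun x : ℝ => (Real.sqrt x)⁻¹) M * cfc (fun x : ℝ => x) M *
          cfc (fun x : ℝ => (Real.sqrt x)⁻¹) M := by rw [cfc_id' ℝ M, invSqrt]
    _ = cfc (fun x : ℝ => (Real.sqrt x)⁻¹ * x * (Real.sqrt x)⁻¹) M := by
        rw [← cfc_mul _ _ M hc hid]
        exact (cfc_mul (fun x : ℝ => (Real.sqrt x)⁻¹ * x) _ M (hc.mul hid) hc).symm
    _ = cfc (fun _ : ℝ => (1 : ℝ)) M := by
        refine cfc_congr fun x hx => ?_
        have hx := Real.sqrt_pos.2 (hpos x hx)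
        have h2 := Real.mul_self_sqrt (Real.sqrt_pos.1 hx).le
        field_simp
        nlinarith
    _ = 1 := cfc_const_one ℝ M

/-- The eigenvalues of `M^{-1/2} G M^{-1/2}` in decreasing order. -/
noncomputable def pencilEigenvalues (M G : Matrix (Fin u) (Fin u) ℝ) (hG : G.IsHermitian) :
    Fin (Fintype.card (Fin u)) → ℝ :=
  (isHermitian_invSqrt_mul M G hG).eigenvalues₀

/-- The substitution x = M^{-1/2} y turns Rayleigh quotients of M^{-1/2} G M^{-1/2} into x'Gx /
x'Mx, so the min-max bounds below need no square roots. -/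
theorem dotProduct_pencil (M G : Matrix (Fin u) (Fin u) ℝ) (y : Fin u → ℝ) :
    y ⬝ᵥ (invSqrt M * G * invSqrt M) *ᵥ y = (invSqrt M *ᵥ y) ⬝ᵥ G *ᵥ (invSqrt M *ᵥ y) := by
  have := dotProduct_mulVec_compress G (invSqrt M) y
  rwa [invSqrt_transpose] at this

theorem dotProduct_self_pencil (hM : M.PosDef) (y : Fin u → ℝ) :
    y ⬝ᵥ y = (invSqrt M *ᵥ y) ⬝ᵥ M *ᵥ (invSqrt M *ᵥ y) := by
  rw [← dotProduct_pencil, invSqrt_mul_mul_invSqrt hM, Matrix.one_mulVec]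

theorem isUnit_invSqrt (hM : M.PosDef) : IsUnit (invSqrt M) :=
  IsUnit.of_mul_eq_one (M * invSqrt M) (by rw [← mul_assoc, invSqrt_mul_mul_invSqrt hM])

/-- `invSqrt M` as a linear equivalence. -/
theorem exists_invSqrt_equiv (hM : M.PosDef) :
    ∃ e : (Fin u → ℝ) ≃ₗ[ℝ] (Fin u → ℝ), ∀ x, e x = invSqrt M *ᵥ x := by
  have hu := isUnit_invSqrt hM
  have hinj : Function.Injective (invSqrt M).mulVecLin :=
    Matrix.mulVec_injective_iff_isUnit.2 hu
  exact ⟨LinearEquiv.ofInjectiveEndo _ hinj, fun x => rfl⟩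

theorem pencilEigenvalues_le_of_forall_mem (hM : M.PosDef) (hG : G.IsHermitian)
    (i : Fin (Fintype.card (Fin u))) (W : Submodule ℝ (Fin u → ℝ)) {c : ℝ}
    (hdim : u ≤ Module.finrank ℝ W + i)
    (hW : ∀ x ∈ W, x ⬝ᵥ G *ᵥ x ≤ c * (x ⬝ᵥ M *ᵥ x)) : pencilEigenvalues M G hG i ≤ c := by
  obtain ⟨e, he⟩ := exists_invSqrt_equiv hM
  refine eigenvalues₀_le_of_forall_mem _ i (W.map (e.symm : (Fin u → ℝ) →ₗ[ℝ] _)) ?_ ?_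
  · rw [LinearEquiv.finrank_map_eq]
    exact (Fintype.card_fin u).le.trans hdim
  · rintro _ ⟨x, hx, rfl⟩
    rw [dotProduct_pencil, dotProduct_self_pencil hM, LinearEquiv.coe_coe, ← he,
      LinearEquiv.apply_symm_apply]
    exact hW x hx

theorem exists_subspace_pencil_le (hM : M.PosDef) (hG : G.IsHermitian)
    (i : Fin (Fintype.card (Fin u))) : ∃ W : Submodule ℝ (Fin u → ℝ),
      u ≤ Module.finrank ℝ W + i ∧
      ∀ x ∈ W, x ⬝ᵥ G *ᵥ x ≤ pencilEigenvalues M G hG i * (x ⬝ᵥ M *ᵥ x) := by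
  obtain ⟨e, he⟩ := exists_invSqrt_equiv hM
  obtain ⟨W, hW, hle⟩ := exists_subspace_forall_mem_le (isHermitian_invSqrt_mul M G hG) i
  refine ⟨W.map (e : (Fin u → ℝ) →ₗ[ℝ] _), ?_, ?_⟩
  · rw [LinearEquiv.finrank_map_eq]
    exact (Fintype.card_fin u).ge.trans hW
  · rintro _ ⟨x, hx, rfl⟩
    have := hle x hx
    rw [dotProduct_pencil, dotProduct_self_pencil hM, ← he] at this
    exact this

theorem le_pencilEigenvalues (hM : M.PosDef) (hG : G.IsHermitian) {c : ℝ}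
    (h : ∀ x : Fin u → ℝ, c * (x ⬝ᵥ M *ᵥ x) ≤ x ⬝ᵥ G *ᵥ x) (i : Fin (Fintype.card (Fin u))) :
    c ≤ pencilEigenvalues M G hG i := by
  refine le_eigenvalues₀ _ (fun y => ?_) i
  rw [dotProduct_pencil, dotProduct_self_pencil hM]
  exact h _

theorem pencilEigenvalues_pos (hM : M.PosDef) (hG : G.PosDef)
    (i : Fin (Fintype.card (Fin u))) : 0 < pencilEigenvalues M G hG.1 i := by
  obtain ⟨C, hC, hle⟩ := exists_dotProduct_self_le hG
  have hsa := isHermitian_invSqrt_mul M G hG.1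
  have hpd : (invSqrt M * G * invSqrt M).PosDef := by
    refine Matrix.PosDef.of_dotProduct_mulVec_pos hsa fun x hx => ?_
    rw [star_trivial, dotProduct_pencil]
    have hne : invSqrt M *ᵥ x ≠ 0 := fun h =>
      hx ((Matrix.mulVec_injective_iff_isUnit.2 (isUnit_invSqrt hM)) (by rw [h, Matrix.mulVec_zero]))
    simpa using hG.dotProduct_mulVec_pos hne
  obtain ⟨C, hC, hle⟩ := exists_dotProduct_self_le hpd
  have := le_eigenvalues₀ hsa (c := C⁻¹) (fun x => by
    rw [inv_mul_le_iff₀ hC]; exact hle x) i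
  exact (inv_pos.2 hC).trans_le this

theorem prod_pencilEigenvalues (hM : M.PosDef) (hG : G.IsHermitian) :
    M.det * ∏ i, pencilEigenvalues M G hG i = G.det := by
  have h1 := congrArg Matrix.det (invSqrt_mul_mul_invSqrt hM)
  have h2 := det_eq_prod_eigenvalues₀ (isHermitian_invSqrt_mul M G hG)
  rw [Matrix.det_mul, Matrix.det_mul] at h1 h2
  rw [Matrix.det_one] at h1
  have h3 : ∏ i, pencilEigenvalues M G hG i = (invSqrt M).det * G.det * (invSqrt M).det := h2.symm
  rw [h3]
  linear_combination G.det * h1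

/-- Since M^{-1/2} G M^{-1/2} has determinant |G|/|M|, comparisons of determinants reduce to bounds
on pencil eigenvalues. -/
theorem log_det_sub_log_det (hM : M.PosDef) (hG : G.PosDef) :
    Real.log G.det - Real.log M.det = ∑ i, Real.log (pencilEigenvalues M G hG.1 i) := by
  rw [← prod_pencilEigenvalues hM hG.1, Real.log_mul hM.det_pos.ne'
    (Finset.prod_pos fun i _ => pencilEigenvalues_pos hM hG i).ne',
    Real.log_prod fun i _ => (pencilEigenvalues_pos hM hG i).ne']
  ring

/-- The determinant is monotone on positive definite matrices. -/
theorem log_det_le_of_forall_le (hM : M.PosDef) (hG : G.PosDef)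
    (h : ∀ x : Fin u → ℝ, x ⬝ᵥ M *ᵥ x ≤ x ⬝ᵥ G *ᵥ x) : Real.log M.det ≤ Real.log G.det := by
  rw [← sub_nonneg, log_det_sub_log_det hM hG]
  exact Finset.sum_nonneg fun i _ => Real.log_nonneg
    (le_pencilEigenvalues hM hG.1 (fun x => by rw [one_mul]; exact h x) i)

/-- The monotonicity of the determinant is strict. -/
theorem dotProduct_mulVec_eq_of_log_det_le (hM : M.PosDef) (hG : G.PosDef)
    (h : ∀ x : Fin u → ℝ, x ⬝ᵥ M *ᵥ x ≤ x ⬝ᵥ G *ᵥ x) (hdet : Real.log G.det ≤ Real.log M.det)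
    (x : Fin u → ℝ) : x ⬝ᵥ G *ᵥ x = x ⬝ᵥ M *ᵥ x := by
  refine le_antisymm ?_ (h x)
  rcases Nat.eq_zero_or_pos u with rfl | hu
  · simp [Subsingleton.elim x 0]
  have h1 := fun i => le_pencilEigenvalues hM hG.1 (c := 1) (fun x => by rw [one_mul]; exact h x) i
  have h0 : ∑ i, Real.log (pencilEigenvalues M G hG.1 i) = 0 := by
    rw [← log_det_sub_log_det hM hG]
    have := log_det_le_of_forall_le hM hG h
    linarith
  -- Index 0 is the largest eigenvalue. All logarithms are nonnegative with sum zero, so it is 1,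
  -- and the subspace attaining it in min-max is the whole space.
  let i₀ : Fin (Fintype.card (Fin u)) := ⟨0, by simpa using hu⟩
  have h2 := (Finset.sum_eq_zero_iff_of_nonneg fun i _ => Real.log_nonneg (h1 i)).1 h0 i₀
    (Finset.mem_univ _)
  have h3 : pencilEigenvalues M G hG.1 i₀ = 1 :=
    Real.eq_one_of_pos_of_log_eq_zero (pencilEigenvalues_pos hM hG i₀) h2
  obtain ⟨W, hW, hle⟩ := exists_subspace_pencil_le hM hG.1 i₀
  have hW' : W = ⊤ := Submodule.eq_top_of_finrank_eq (by
    have := Submodule.finrank_le W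
    rw [Module.finrank_fintype_fun_eq_card, Fintype.card_fin] at this ⊢
    simp [i₀] at hW
    omega)
  have := hle x (hW' ▸ Submodule.mem_top)
  rwa [h3, one_mul] at this

/-- The optimal subspace for (M, G) serves as a trial subspace for (M', G'). One factor exp η is
lost in each of the two forms, hence 2η. -/
theorem log_pencilEigenvalues_le {M' G' : Matrix (Fin u) (Fin u) ℝ} {η : ℝ} (hM : M.PosDef)
    (hG : G.PosDef) (hM' : M'.PosDef) (hG' : G'.PosDef) (h1 : LoewnerClose η M M')
    (h2 : LoewnerClose η G G') (i : Fin (Fintype.card (Fin u))) :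
    Real.log (pencilEigenvalues M' G' hG'.1 i) ≤
      Real.log (pencilEigenvalues M G hG.1 i) + 2 * η := by
  have hp := pencilEigenvalues_pos hM hG i
  rw [← Real.log_exp (2 * η), ← Real.log_mul hp.ne' (Real.exp_pos _).ne']
  refine Real.log_le_log (pencilEigenvalues_pos hM' hG' i) ?_
  obtain ⟨W, hW, hle⟩ := exists_subspace_pencil_le hM hG.1 i
  refine pencilEigenvalues_le_of_forall_mem hM' hG'.1 i W hW fun x hx => ?_
  calc x ⬝ᵥ G' *ᵥ x ≤ Real.exp η * (x ⬝ᵥ G *ᵥ x) := (h2 x).1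
    _ ≤ Real.exp η * (pencilEigenvalues M G hG.1 i * (Real.exp η * (x ⬝ᵥ M' *ᵥ x))) := by
        refine mul_le_mul_of_nonneg_left ?_ (Real.exp_pos _).le
        exact (hle x hx).trans (mul_le_mul_of_nonneg_left (h1 x).2 hp.le)
    _ = _ := by rw [two_mul, Real.exp_add]; ring

theorem abs_log_pencilEigenvalues_sub_le {M' G' : Matrix (Fin u) (Fin u) ℝ} {η : ℝ}
    (hM : M.PosDef) (hG : G.PosDef) (hM' : M'.PosDef) (hG' : G'.PosDef) (h1 : LoewnerClose η M M')
    (h2 : LoewnerClose η G G') (i : Fin (Fintype.card (Fin u))) :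
    |Real.log (pencilEigenvalues M' G' hG'.1 i) - Real.log (pencilEigenvalues M G hG.1 i)| ≤
      2 * η := by
  have a := log_pencilEigenvalues_le hM hG hM' hG' h1 h2 i
  have b := log_pencilEigenvalues_le hM' hG' hM hG h1.symm h2.symm i
  exact abs_le.2 ⟨by linarith, by linarith⟩

theorem log_det_le_add {η : ℝ} (hM : M.PosDef) (hG : G.PosDef) (h : LoewnerClose η M G) :
    Real.log G.det ≤ Real.log M.det + u * η := by
  rw [← sub_le_iff_le_add', log_det_sub_log_det hM hG]
  calc ∑ i, Real.log (pencilEigenvalues M G hG.1 i)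
      ≤ ∑ _i : Fin (Fintype.card (Fin u)), η := by
        refine Finset.sum_le_sum fun i _ => ?_
        rw [← Real.log_exp η]
        refine Real.log_le_log (pencilEigenvalues_pos hM hG i) ?_
        refine pencilEigenvalues_le_of_forall_mem hM hG.1 i ⊤ ?_ fun x _ => (h x).1
        simp
    _ = u * η := by simp

theorem abs_log_det_sub_le {η : ℝ} (hM : M.PosDef) (hG : G.PosDef) (h : LoewnerClose η M G) :
    |Real.log G.det - Real.log M.det| ≤ u * η := by
  have a := log_det_le_add hM hG h
  have b := log_det_le_add hG hM h.symm
  exact abs_le.2 ⟨by linarith, by linarith⟩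

end Pencil

/-! The objective function as a function of compressed matrices -/

section Objective

variable {u : ℕ}

/-- The objective function of three compressed matrices. -/
noncomputable def coreObjective (d : ℕ) (M K G : Matrix (Fin u) (Fin u) ℝ)
    (hG : G.IsHermitian) : ℝ :=
  Real.log M.det + Real.log K.det +
    ∑ i : Fin (Fintype.card (Fin u)) with d ≤ i.val, Real.log (pencilEigenvalues M G hG i)

/-- The constant 4u is u for each of the two log-determinants and 2 for each of at most u
eigenvalues. -/
theorem abs_coreObjective_sub_le (d : ℕ) {M K G M' K' G' : Matrix (Fin u) (Fin u) ℝ}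
    (hM : M.PosDef) (hK : K.PosDef) (hG : G.PosDef) (hM' : M'.PosDef) (hK' : K'.PosDef)
    (hG' : G'.PosDef) {η : ℝ} (hη : 0 ≤ η) (h1 : LoewnerClose η M M') (h2 : LoewnerClose η K K')
    (h3 : LoewnerClose η G G') :
    |coreObjective d M' K' G' hG'.1 - coreObjective d M K G hG.1| ≤ 4 * u * η := by
  have a := abs_log_det_sub_le hM hM' h1
  have b := abs_log_det_sub_le hK hK' h2
  have c : |∑ i : Fin (Fintype.card (Fin u)) with d ≤ i.val,
      (Real.log (pencilEigenvalues M' G' hG'.1 i) - Real.log (pencilEigenvalues M G hG.1 i))| ≤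
      u * (2 * η) := by
    calc _ ≤ ∑ i : Fin (Fintype.card (Fin u)) with d ≤ i.val,
          |Real.log (pencilEigenvalues M' G' hG'.1 i) -
            Real.log (pencilEigenvalues M G hG.1 i)| := Finset.abs_sum_le_sum_abs _ _
      _ ≤ ∑ i : Fin (Fintype.card (Fin u)) with d ≤ i.val, 2 * η :=
          Finset.sum_le_sum fun i _ => abs_log_pencilEigenvalues_sub_le hM hG hM' hG' h1 h3 i
      _ ≤ ∑ _i : Fin (Fintype.card (Fin u)), 2 * η :=
          Finset.sum_le_sum_of_subset_of_nonneg (Finset.filter_subset _ _)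
            fun _ _ _ => by positivity
      _ = u * (2 * η) := by simp
  rw [Finset.sum_sub_distrib] at c
  unfold coreObjective
  rw [abs_le] at a b c ⊢
  constructor <;> linarith

end Objective

/-! Minimization over semiorthogonal matrices -/

section Semiorthogonal

variable {q u : ℕ}

theorem isCompact_setOf_isSemiorthogonal :
    IsCompact {D : Matrix (Fin q) (Fin u) ℝ | IsSemiorthogonal D} := by
  have hbox : IsCompact (Set.pi Set.univ fun _ : Fin q => Set.pi Set.univ fun _ : Fin u =>
      Set.Icc (-1 : ℝ) 1) :=
    isCompact_univ_pi fun _ => isCompact_univ_pi fun _ => isCompact_Icc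
  refine hbox.of_isClosed_subset ?_ ?_
  · have : Continuous fun D : Matrix (Fin q) (Fin u) ℝ => Dᵀ * D := by fun_prop
    exact isClosed_singleton.preimage this
  · intro (D : Matrix (Fin q) (Fin u) ℝ) hD i _ j _
    have h1 : (Dᵀ * D) j j = 1 := by rw [show Dᵀ * D = 1 from hD]; simp
    rw [Matrix.mul_apply] at h1
    have h2 := Finset.single_le_sum (f := fun k => Dᵀ j k * D k j)
      (fun k _ => by simpa using mul_self_nonneg (D k j)) (Finset.mem_univ i)
    simp only [Matrix.transpose_apply] at h1 h2
    exact abs_le.1 (abs_le_one_iff_mul_self_le_one.2 (h2.trans h1.le))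

theorem IsSemiorthogonal.posDef_compress {D : Matrix (Fin q) (Fin u) ℝ} (hD : IsSemiorthogonal D)
    {M : Matrix (Fin q) (Fin q) ℝ} (hM : M.PosDef) : (Dᵀ * M * D).PosDef :=
  REVAR.posDef_compress hM hD

theorem eventually_loewnerClose_compress {M : Matrix (Fin q) (Fin q) ℝ} (hM : M.PosDef)
    {D : Matrix (Fin q) (Fin u) ℝ} (hD : IsSemiorthogonal D) {η : ℝ} (hη : 0 < η) :
    ∀ᶠ D' in 𝓝 D, LoewnerClose η (Dᵀ * M * D) (D'ᵀ * M * D') := by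
  have hc : Continuous fun D' : Matrix (Fin q) (Fin u) ℝ => D'ᵀ * M * D' := by fun_prop
  exact hc.continuousAt.eventually (eventually_loewnerClose (hD.posDef_compress hM) hη)

theorem continuousOn_coreObjective (d : ℕ) {R K S : Matrix (Fin q) (Fin q) ℝ} (hR : R.PosDef)
    (hK : K.PosDef) (hS : S.PosDef)
    (hh : ∀ D : Matrix (Fin q) (Fin u) ℝ, (Dᵀ * S * D).IsHermitian) :
    ContinuousOn (fun D : Matrix (Fin q) (Fin u) ℝ =>
      coreObjective d (Dᵀ * R * D) (Dᵀ * K * D) (Dᵀ * S * D) (hh D))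
      {D | IsSemiorthogonal D} := by
  intro D hD
  rw [ContinuousWithinAt, Metric.tendsto_nhds]
  intro ε hε
  -- The extra 1 avoids division by zero when u = 0 and makes the final inequality strict.
  have hη : 0 < ε / (4 * u + 1) := by positivity
  filter_upwards [self_mem_nhdsWithin,
    nhdsWithin_le_nhds (eventually_loewnerClose_compress hR hD hη),
    nhdsWithin_le_nhds (eventually_loewnerClose_compress hK hD hη),
    nhdsWithin_le_nhds (eventually_loewnerClose_compress hS hD hη)] with D' hD' h1 h2 h3
  have := abs_coreObjective_sub_le d (hD.posDef_compress hR) (hD.posDef_compress hK)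
    (hD.posDef_compress hS) (IsSemiorthogonal.posDef_compress hD' hR)
    (IsSemiorthogonal.posDef_compress hD' hK) (IsSemiorthogonal.posDef_compress hD' hS)
    hη.le h1 h2 h3
  rw [Real.dist_eq]
  refine this.trans_lt ?_
  rw [mul_div_assoc', div_lt_iff₀ (by positivity)]
  linarith

theorem continuousOn_popObjective {M G : Matrix (Fin q) (Fin q) ℝ} (hM : M.PosDef)
    (hG : G.PosDef) : ContinuousOn (popObjective M G : Matrix (Fin q) (Fin u) ℝ → ℝ)
      {D | IsSemiorthogonal D} := by
  have hc : ∀ N : Matrix (Fin q) (Fin q) ℝ, N.PosDef →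
      ContinuousOn (fun D : Matrix (Fin q) (Fin u) ℝ => Real.log (Dᵀ * N * D).det)
      {D | IsSemiorthogonal D} := fun N hN => by
    refine ContinuousOn.log (Continuous.continuousOn ?_) fun D hD =>
      (IsSemiorthogonal.posDef_compress hD hN).det_pos.ne'
    fun_prop
  exact (hc M hM).add (hc G⁻¹ hG.inv)

theorem exists_isArgmin {F : Matrix (Fin q) (Fin u) ℝ → ℝ}
    (hF : ContinuousOn F {D | IsSemiorthogonal D})
    (hne : ∃ D : Matrix (Fin q) (Fin u) ℝ, IsSemiorthogonal D) : ∃ D, IsArgmin F D := by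
  obtain ⟨D, hD, hmin⟩ := isCompact_setOf_isSemiorthogonal.exists_isMinOn hne hF
  exact ⟨D, hD, fun D' hD' => hmin hD'⟩

theorem exists_isArgmin_sampleObjective (p d T : ℕ) {y : ℤ → Fin q → ℝ}
    (hR : (residCov p T y).PosDef) (hS : (sampleCov T y y).PosDef)
    (hne : ∃ D : Matrix (Fin q) (Fin u) ℝ, IsSemiorthogonal D) :
    ∃ D : Matrix (Fin q) (Fin u) ℝ, IsArgmin (sampleObjective p d T y) D :=
  -- By definitional unfolding, `sampleObjective` is `coreObjective` at the compressions of the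
  -- residual covariance, the inverse sample covariance and the sample covariance.
  exists_isArgmin (continuousOn_coreObjective d hR hS.inv hS (isHermitian_compress T y)) hne

/-- Minimizers of functions uniformly close to `F` are close to the minimizers of `F`. -/
theorem exists_forall_isArgmin_mem {F : Matrix (Fin q) (Fin u) ℝ → ℝ}
    (hF : ContinuousOn F {D | IsSemiorthogonal D}) {U : Set (Matrix (Fin q) (Fin u) ℝ)}
    (hU : IsOpen U) (hFU : ∀ D, IsArgmin F D → D ∈ U) :
    ∃ κ > 0, ∀ H : Matrix (Fin q) (Fin u) ℝ → ℝ,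
      (∀ D, IsSemiorthogonal D → |H D - F D| < κ) → ∀ D, IsArgmin H D → D ∈ U := by
  by_cases hne : ∃ D : Matrix (Fin q) (Fin u) ℝ, IsSemiorthogonal D
  swap
  · exact ⟨1, one_pos, fun H _ D hD => (hne ⟨D, hD.1⟩).elim⟩
  obtain ⟨D₀, hD₀⟩ := exists_isArgmin hF hne
  have hK : IsCompact ({D : Matrix (Fin q) (Fin u) ℝ | IsSemiorthogonal D} \ U) :=
    isCompact_setOf_isSemiorthogonal.diff hU
  by_cases hKne : ({D : Matrix (Fin q) (Fin u) ℝ | IsSemiorthogonal D} \ U).Nonempty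
  swap
  · refine ⟨1, one_pos, fun H _ D hD => ?_⟩
    by_contra h
    exact hKne ⟨D, hD.1, h⟩
  obtain ⟨D₁, hD₁, hmin⟩ := hK.exists_isMinOn hKne (hF.mono Set.sdiff_subset)
  have hlt : F D₀ < F D₁ := by
    refine lt_of_le_of_ne (hD₀.2 D₁ hD₁.1) fun h => hD₁.2 (hFU D₁ ⟨hD₁.1, fun D' hD' => ?_⟩)
    rw [← h]
    exact hD₀.2 D' hD'
  -- `D₁` is the best point outside `U`, and it is strictly worse than `D₀`, for otherwise it would
  -- be a minimizer outside `U`. A perturbation below half this gap cannot move a minimizer out of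
  -- `U`.
  refine ⟨(F D₁ - F D₀) / 2, by linarith, fun H hH D hD => ?_⟩
  by_contra h
  have h1 : F D₁ ≤ F D := hmin ⟨hD.1, h⟩
  have h2 := hD.2 D₀ hD₀.1
  have h3 := abs_lt.1 (hH D hD.1)
  have h4 := abs_lt.1 (hH D₀ hD₀.1)
  linarith [h3.1, h3.2, h4.1, h4.2]

end Semiorthogonal

/-! Uniform closeness of the sample and the population objective functions -/

section Uniform

variable {q u : ℕ}

theorem continuousAt_matrix_inv {n : Type*} [Fintype n] [DecidableEq n] {M : Matrix n n ℝ}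
    (hM : M.det ≠ 0) : ContinuousAt (fun N : Matrix n n ℝ => N⁻¹) M := by
  have h : (fun N : Matrix n n ℝ => N⁻¹) = fun N => N.det⁻¹ • N.adjugate := by
    funext N
    rw [Matrix.inv_def, Ring.inverse_eq_inv']
  rw [h]
  have h1 : Continuous fun N : Matrix n n ℝ => N.det := by fun_prop
  have h2 : Continuous fun N : Matrix n n ℝ => N.adjugate := by fun_prop
  exact (h1.continuousAt.inv₀ hM).smul h2.continuousAt

/-- The two compressed forms agree on the kernel of B'D, whose dimension is at least u - rank B,
giving the upper bound 1. The second form dominates the first everywhere, giving the lower bound 1.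
-/
theorem pencilEigenvalues_eq_one {n : Type*} [Fintype n] {M : Matrix (Fin q) (Fin q) ℝ}
    {B : Matrix (Fin q) n ℝ} {N : Matrix n n ℝ} (hM : M.PosDef) (hN : N.PosSemidef)
    {D : Matrix (Fin q) (Fin u) ℝ} (hD : IsSemiorthogonal D)
    (hG : (Dᵀ * (M + B * N * Bᵀ) * D).IsHermitian) (i : Fin (Fintype.card (Fin u)))
    (hi : B.rank ≤ i) :
    pencilEigenvalues (Dᵀ * M * D) (Dᵀ * (M + B * N * Bᵀ) * D) hG i = 1 := by
  have hform : ∀ x : Fin u → ℝ, x ⬝ᵥ (Dᵀ * (M + B * N * Bᵀ) * D) *ᵥ x =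
      x ⬝ᵥ (Dᵀ * M * D) *ᵥ x + ((Bᵀ * D) *ᵥ x) ⬝ᵥ N *ᵥ ((Bᵀ * D) *ᵥ x) := fun x => by
    have h1 := dotProduct_mulVec_compress N Bᵀ (D *ᵥ x)
    rw [Matrix.transpose_transpose] at h1
    rw [dotProduct_mulVec_compress, dotProduct_mulVec_compress, Matrix.add_mulVec,
      dotProduct_add, h1, ← Matrix.mulVec_mulVec x Bᵀ D]
  have hMD := hD.posDef_compress hM
  refine le_antisymm ?_ ?_
  · refine pencilEigenvalues_le_of_forall_mem hMD hG i (LinearMap.ker (Bᵀ * D).mulVecLin) ?_ ?_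
    · have h1 := (Bᵀ * D).mulVecLin.finrank_range_add_finrank_ker
      rw [Module.finrank_fintype_fun_eq_card, Fintype.card_fin] at h1
      have h2 : (Bᵀ * D).rank ≤ B.rank := (Matrix.rank_mul_le_left _ _).trans_eq B.rank_transpose
      rw [Matrix.rank] at h2
      omega
    · intro x hx
      have hx' : (Bᵀ * D) *ᵥ x = 0 := hx
      rw [hform, hx', one_mul]
      simp
  · refine le_pencilEigenvalues hMD hG (fun x => ?_) i
    rw [hform, one_mul]
    have := hN.dotProduct_mulVec_nonneg ((Bᵀ * D) *ᵥ x)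
    rw [star_trivial] at this
    linarith

theorem popObjective_eq_coreObjective {n : Type*} [Fintype n] {M : Matrix (Fin q) (Fin q) ℝ}
    {B : Matrix (Fin q) n ℝ} {N : Matrix n n ℝ} (hM : M.PosDef) (hN : N.PosSemidef)
    {D : Matrix (Fin q) (Fin u) ℝ} (hD : IsSemiorthogonal D)
    (hG : (Dᵀ * (M + B * N * Bᵀ) * D).IsHermitian) :
    popObjective M (M + B * N * Bᵀ) D = coreObjective B.rank (Dᵀ * M * D)
      (Dᵀ * (M + B * N * Bᵀ)⁻¹ * D) (Dᵀ * (M + B * N * Bᵀ) * D) hG := by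
  rw [coreObjective, Finset.sum_eq_zero, add_zero, popObjective]
  intro i hi
  rw [pencilEigenvalues_eq_one hM hN hD hG i (Finset.mem_filter.1 hi).2, Real.log_one]

theorem posDef_add_mul_mul_transpose {n : Type*} [Fintype n] {M : Matrix (Fin q) (Fin q) ℝ}
    (B : Matrix (Fin q) n ℝ) {N : Matrix n n ℝ} (hM : M.PosDef) (hN : N.PosSemidef) :
    (M + B * N * Bᵀ).PosDef := by
  have := hM.add_posSemidef (hN.mul_mul_conjTranspose_same B)
  simpa using this

/-- Close to the population moments the sample objective function is uniformly close to the
population objective function. -/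
theorem eventually_abs_coreObjective_sub_lt {n : Type*} [Fintype n] {M : Matrix (Fin q) (Fin q) ℝ}
    (B : Matrix (Fin q) n ℝ) {N : Matrix n n ℝ} (hM : M.PosDef) (hN : N.PosSemidef) {δ : ℝ}
    (hδ : 0 < δ) :
    ∀ᶠ RS : Matrix (Fin q) (Fin q) ℝ × Matrix (Fin q) (Fin q) ℝ in 𝓝 (M, M + B * N * Bᵀ),
      RS.1.IsHermitian → RS.2.IsHermitian → RS.1.PosDef ∧ RS.2.PosDef ∧
        ∀ D : Matrix (Fin q) (Fin u) ℝ, IsSemiorthogonal D →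
          ∀ hG, |coreObjective B.rank (Dᵀ * RS.1 * D) (Dᵀ * RS.2⁻¹ * D) (Dᵀ * RS.2 * D) hG -
            popObjective M (M + B * N * Bᵀ) D| < δ := by
  have hG := posDef_add_mul_mul_transpose B hM hN
  have hη : 0 < δ / (4 * u + 1) := by positivity
  have e1 := (continuous_fst.tendsto (M, M + B * N * Bᵀ)).eventually
    (eventually_loewnerClose hM hη)
  have e2 := (continuous_snd.tendsto (M, M + B * N * Bᵀ)).eventually
    (eventually_loewnerClose hG hη)
  have e3 := (continuous_snd.tendsto (M, M + B * N * Bᵀ)).eventually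
    ((continuousAt_matrix_inv hG.det_pos.ne').eventually (eventually_loewnerClose hG.inv hη))
  filter_upwards [e1, e2, e3] with RS h1 h2 h3 hR hS
  have hR' := h1.posDef hM hR
  have hS' := h2.posDef hG hS
  refine ⟨hR', hS', fun D hD hGD => ?_⟩
  have := abs_coreObjective_sub_le B.rank (hD.posDef_compress hM) (hD.posDef_compress hG.inv)
    (hD.posDef_compress hG) (hD.posDef_compress hR') (hD.posDef_compress hS'.inv)
    (hD.posDef_compress hS') hη.le (h1.compress D) (h3.compress D) (h2.compress D)
  rw [popObjective_eq_coreObjective hM hN hD (hD.posDef_compress hG).1]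
  refine this.trans_lt ?_
  rw [mul_div_assoc', div_lt_iff₀ (by positivity)]
  linarith

end Uniform

/-! Column spans, projections and reducing subspaces in terms of semiorthogonal matrices -/

section ColSpan

variable {q u : ℕ}

theorem mem_colSpan_iff {n : Type*} [Fintype n] {M : Matrix (Fin q) n ℝ}
    {v : EuclideanSpace ℝ (Fin q)} : v ∈ colSpan M ↔ ∃ w : n → ℝ, WithLp.toLp 2 (M *ᵥ w) = v := by
  rw [colSpan, Submodule.mem_span_range_iff_exists_fun]
  refine exists_congr fun w => ?_
  have : (∑ j, w j • WithLp.toLp 2 (fun i => M i j) : EuclideanSpace ℝ (Fin q)) =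
      WithLp.toLp 2 (M *ᵥ w) := by
    ext i
    simp [Matrix.mulVec, dotProduct, mul_comm]
  rw [this]

theorem inner_toLp_toLp (v w : Fin q → ℝ) :
    inner ℝ (WithLp.toLp 2 v : EuclideanSpace ℝ (Fin q)) (WithLp.toLp 2 w) = v ⬝ᵥ w := by
  simp [PiLp.inner_apply, dotProduct, mul_comm]

theorem starProjection_colSpan {D : Matrix (Fin q) (Fin u) ℝ} (hD : IsSemiorthogonal D) :
    (colSpan D).starProjection = Matrix.toEuclideanCLM (n := Fin q) (𝕜 := ℝ) (D * Dᵀ) := by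
  ext1 v
  obtain ⟨v, rfl⟩ := (WithLp.toLp_surjective 2) v
  rw [Matrix.toEuclideanCLM_toLp]
  refine Submodule.eq_starProjection_of_mem_of_inner_eq_zero (K := colSpan D) ?_ ?_
  · exact mem_colSpan_iff.2 ⟨Dᵀ *ᵥ v, by rw [Matrix.mulVec_mulVec]⟩
  · intro w hw
    obtain ⟨w, rfl⟩ := mem_colSpan_iff.1 hw
    rw [← WithLp.toLp_sub, inner_toLp_toLp, Matrix.dotProduct_mulVec, ← Matrix.mulVec_transpose,
      Matrix.mulVec_sub, Matrix.mulVec_mulVec, ← Matrix.mul_assoc,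
      show Dᵀ * D = 1 from hD, Matrix.one_mul, sub_self, zero_dotProduct]

theorem mul_transpose_eq_of_colSpan_eq {D E : Matrix (Fin q) (Fin u) ℝ} (hD : IsSemiorthogonal D)
    (hE : IsSemiorthogonal E) (h : colSpan D = colSpan E) : D * Dᵀ = E * Eᵀ := by
  have h1 := starProjection_colSpan hD
  have h2 := starProjection_colSpan hE
  have h3 : (colSpan D).starProjection = (colSpan E).starProjection := by rw [h]
  rw [h1, h2] at h3
  exact Matrix.toEuclideanCLM.injective h3

/-- Semiorthogonal matrices with the same span differ by a rotation. -/
theorem exists_orthogonal_mul_eq {D E : Matrix (Fin q) (Fin u) ℝ} (hD : IsSemiorthogonal D)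
    (hE : IsSemiorthogonal E) (h : colSpan D = colSpan E) :
    ∃ O ∈ Matrix.orthogonalGroup (Fin u) ℝ, E * O = D := by
  have hP := mul_transpose_eq_of_colSpan_eq hD hE h
  refine ⟨Eᵀ * D, ?_, ?_⟩
  · rw [Matrix.mem_orthogonalGroup_iff', Matrix.transpose_mul, Matrix.transpose_transpose]
    calc Dᵀ * E * (Eᵀ * D) = Dᵀ * (E * Eᵀ) * D := by simp only [Matrix.mul_assoc]
      _ = (Dᵀ * D) * (Dᵀ * D) := by rw [← hP]; simp only [Matrix.mul_assoc]
      _ = 1 := by rw [show Dᵀ * D = 1 from hD, Matrix.one_mul]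
  · rw [← Matrix.mul_assoc, ← hP, Matrix.mul_assoc, show Dᵀ * D = 1 from hD, Matrix.mul_one]

theorem finrank_colSpan {D : Matrix (Fin q) (Fin u) ℝ} (hD : IsSemiorthogonal D) :
    Module.finrank ℝ (colSpan D) = u := by
  have hli : LinearIndependent ℝ
      (fun j : Fin u => (WithLp.toLp 2 (fun i => D i j) : EuclideanSpace ℝ (Fin q))) := by
    refine Orthonormal.linearIndependent (𝕜 := ℝ) ?_
    rw [orthonormal_iff_ite]
    intro i j
    rw [inner_toLp_toLp]
    have := congrFun (congrFun (show Dᵀ * D = 1 from hD) i) j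
    rw [Matrix.one_apply] at this
    exact this
  rw [colSpan, finrank_span_eq_card hli, Fintype.card_fin]

theorem exists_semiorthogonal_colSpan_eq (R : Submodule ℝ (EuclideanSpace ℝ (Fin q)))
    (hR : Module.finrank ℝ R = u) :
    ∃ D : Matrix (Fin q) (Fin u) ℝ, IsSemiorthogonal D ∧ colSpan D = R := by
  subst hR
  let b := stdOrthonormalBasis ℝ R
  refine ⟨Matrix.of fun i j => (b j : EuclideanSpace ℝ (Fin q)) i, ?_, ?_⟩
  · rw [IsSemiorthogonal]
    ext i j
    have h1 := (orthonormal_iff_ite.1 b.orthonormal) i j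
    rw [Submodule.coe_inner, PiLp.inner_apply] at h1
    rw [Matrix.one_apply, ← h1, Matrix.mul_apply]
    exact Finset.sum_congr rfl fun k _ => by simp [mul_comm]
  · have h1 : (fun j => WithLp.toLp 2 (fun i => (Matrix.of fun i j =>
        (b j : EuclideanSpace ℝ (Fin q)) i) i j)) = fun j => R.subtype (b j) := by
      funext j
      ext i
      simp
    rw [colSpan, h1, Set.range_comp' R.subtype b, Submodule.span_image]
    have h2 := b.toBasis.span_eq
    rw [OrthonormalBasis.coe_toBasis] at h2
    rw [h2, Submodule.map_subtype_top]

/-- Semiorthogonal matrices have an orthogonal complement. -/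
theorem exists_complement {D : Matrix (Fin q) (Fin u) ℝ} (hD : IsSemiorthogonal D) :
    ∃ (k : ℕ) (C : Matrix (Fin q) (Fin k) ℝ), IsSemiorthogonal C ∧ Dᵀ * C = 0 ∧ Cᵀ * D = 0 ∧
      D * Dᵀ + C * Cᵀ = 1 := by
  have huq : u ≤ q := by
    have h1 := finrank_colSpan hD
    have h2 := Submodule.finrank_le (colSpan D)
    rw [finrank_euclideanSpace_fin] at h2
    omega
  -- The zeros are placeholders: only the values on the left summand are required to be orthonormal
  -- and are kept by the extension to a basis.
  let v : Fin u ⊕ Fin (q - u) → EuclideanSpace ℝ (Fin q) :=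
    Sum.elim (fun j => WithLp.toLp 2 (fun i => D i j)) 0
  have hv : Orthonormal ℝ ((Set.range Sum.inl).domRestrict v) := by
    rw [orthonormal_iff_ite]
    rintro ⟨_, i, rfl⟩ ⟨_, j, rfl⟩
    have := congrFun (congrFun (show Dᵀ * D = 1 from hD) i) j
    rw [Matrix.one_apply] at this
    have e : inner ℝ (v (Sum.inl i)) (v (Sum.inl j)) = if i = j then 1 else 0 := by
      rw [← this]
      exact inner_toLp_toLp _ _
    refine Eq.trans e (if_congr ⟨fun h => by rw [h], fun h => ?_⟩ rfl rfl)
    exact Sum.inl_injective (congrArg Subtype.val h)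
  have hcard : Module.finrank ℝ (EuclideanSpace ℝ (Fin q)) =
      Fintype.card (Fin u ⊕ Fin (q - u)) := by
    simp [huq]
  obtain ⟨b, hb⟩ := hv.exists_orthonormalBasis_extension_of_card_eq hcard
  have hbD : ∀ i j, b (Sum.inl j) i = D i j := fun i j => by
    rw [hb _ ⟨j, rfl⟩]
    rfl
  have hin : ∀ a c, ∑ i, b a i * b c i = if a = c then 1 else 0 := fun a c => by
    rw [← (orthonormal_iff_ite.1 b.orthonormal) a c, PiLp.inner_apply]
    exact Finset.sum_congr rfl fun k _ => by simp [mul_comm]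
  let C : Matrix (Fin q) (Fin (q - u)) ℝ := Matrix.of fun i j => b (Sum.inr j) i
  have h1 : Cᵀ * C = 1 := by
    ext i j
    rw [Matrix.mul_apply, Matrix.one_apply]
    simpa [C] using hin (Sum.inr i) (Sum.inr j)
  have h2 : Dᵀ * C = 0 := by
    ext i j
    rw [Matrix.mul_apply]
    simpa [C, hbD] using hin (Sum.inl i) (Sum.inr j)
  have h3 : Cᵀ * D = 0 := by
    have := congrArg Matrix.transpose h2
    simpa using this
  refine ⟨q - u, C, h1, h2, h3, ?_⟩
  -- The block matrix (D, C) is square, so the relations already proved, which make its transpose a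
  -- left inverse, make it a right inverse as well.
  rw [← Matrix.fromCols_mul_fromRows, Matrix.fromCols_mul_fromRows_eq_one_comm
    (Fintype.equivOfCardEq (by simp [huq])), Matrix.fromRows_mul_fromCols, h1, h2, h3,
    show Dᵀ * D = 1 from hD, Matrix.fromBlocks_one]

end ColSpan

/-! ### Invariance of reducing subspaces and envelopes -/

section Envelope

variable {q u : ℕ}

theorem Reduces.apply_mem {R : Submodule ℝ (EuclideanSpace ℝ (Fin q))}
    {M : Matrix (Fin q) (Fin q) ℝ} (h : Reduces R M) {v : EuclideanSpace ℝ (Fin q)} (hv : v ∈ R) :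
    Matrix.toEuclideanCLM (n := Fin q) (𝕜 := ℝ) M v ∈ R := by
  have hv' : R.starProjection v = v := Submodule.starProjection_eq_self_iff.2 hv
  rw [show Matrix.toEuclideanCLM (n := Fin q) (𝕜 := ℝ) M = _ from h]
  simp only [add_apply, mul_apply_eq_comp, sub_apply, one_apply_eq_self, hv', sub_self, map_zero, add_zero]
  exact Submodule.starProjection_apply_mem _ _

/-- Invariance under M passes to intersections at once. For symmetric M this is all that
`popObjective_of_reducing` needs, so the envelope itself need not be shown to reduce M. -/
theorem envelope_apply_mem {M : Matrix (Fin q) (Fin q) ℝ}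
    {S : Submodule ℝ (EuclideanSpace ℝ (Fin q))} {v : EuclideanSpace ℝ (Fin q)}
    (hv : v ∈ envelope M S) :
    Matrix.toEuclideanCLM (n := Fin q) (𝕜 := ℝ) M v ∈ envelope M S := by
  rw [envelope, Submodule.mem_sInf] at hv ⊢
  exact fun R hR => hR.1.apply_mem (hv R hR)

theorem le_envelope (M : Matrix (Fin q) (Fin q) ℝ) (S : Submodule ℝ (EuclideanSpace ℝ (Fin q))) :
    S ≤ envelope M S :=
  le_sInf fun _ hR => hR.2

theorem colSpan_le_colSpan_iff {n : Type*} {D : Matrix (Fin q) (Fin u) ℝ}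
    {B : Matrix (Fin q) n ℝ} (hD : IsSemiorthogonal D) :
    colSpan B ≤ colSpan D ↔ D * Dᵀ * B = B := by
  rw [colSpan, Submodule.span_le, Set.range_subset_iff]
  have : ∀ j, (WithLp.toLp 2 (fun i => B i j) ∈ (colSpan D : Set (EuclideanSpace ℝ (Fin q)))) ↔
      ∀ i, (D * Dᵀ * B) i j = B i j := fun j => by
    rw [SetLike.mem_coe, ← Submodule.starProjection_eq_self_iff, starProjection_colSpan hD,
      Matrix.toEuclideanCLM_toLp, (WithLp.toLp_injective 2).eq_iff, funext_iff]
    rfl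
  rw [forall_congr' this, ← Matrix.ext_iff]
  exact forall_comm

end Envelope

/-! Minimizers of the population objective function -/

section Population

variable {q u k : ℕ}

/-- Jacobi's identity for complementary minors in the orthonormal basis (D, C). The columns `V` =
(G⁻¹D, C) are chosen so that both `V` and GV are block triangular in this basis; comparing
determinants gives the claim. -/
theorem det_compress_inv {G : Matrix (Fin q) (Fin q) ℝ} (hG : IsUnit G.det)
    {D : Matrix (Fin q) (Fin u) ℝ} {C : Matrix (Fin q) (Fin k) ℝ} (hD : IsSemiorthogonal D)
    (hC : IsSemiorthogonal C) (hDC : Dᵀ * C = 0) (hCD : Cᵀ * D = 0)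
    (h1 : D * Dᵀ + C * Cᵀ = 1) : (Cᵀ * G * C).det = G.det * (Dᵀ * G⁻¹ * D).det := by
  let W : Matrix (Fin q) (Fin u ⊕ Fin k) ℝ := Matrix.fromCols D C
  let Wt : Matrix (Fin u ⊕ Fin k) (Fin q) ℝ := Matrix.fromRows Dᵀ Cᵀ
  let V : Matrix (Fin q) (Fin u ⊕ Fin k) ℝ := Matrix.fromCols (G⁻¹ * D) C
  have hWW : W * Wt = 1 := by rw [Matrix.fromCols_mul_fromRows, h1]
  have hWW' : Wt * W = 1 := by
    rw [Matrix.fromRows_mul_fromCols, hDC, hCD, show Dᵀ * D = 1 from hD,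
      show Cᵀ * C = 1 from hC, Matrix.fromBlocks_one]
  have e1 : Wt * V = Matrix.fromBlocks (Dᵀ * G⁻¹ * D) 0 (Cᵀ * G⁻¹ * D) 1 := by
    rw [Matrix.fromRows_mul_fromCols, hDC, show Cᵀ * C = 1 from hC]
    simp only [Matrix.mul_assoc]
  have e2 : Wt * G * V = Matrix.fromBlocks 1 (Dᵀ * G * C) 0 (Cᵀ * G * C) := by
    rw [Matrix.fromRows_mul, Matrix.fromRows_mul_fromCols]
    have : ∀ {m : ℕ} (A : Matrix (Fin m) (Fin q) ℝ), A * G * (G⁻¹ * D) = A * D := fun A => by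
      rw [Matrix.mul_assoc, ← Matrix.mul_assoc G, Matrix.mul_nonsing_inv _ hG, Matrix.one_mul]
    rw [this, this, hCD, show Dᵀ * D = 1 from hD]
  have e3 : Wt * G * V = (Wt * G * W) * (Wt * V) := by
    calc Wt * G * V = Wt * G * (W * Wt) * V := by rw [hWW, Matrix.mul_one]
      _ = _ := by simp only [Matrix.mul_assoc]
  have e4 : (Wt * G * W).det = G.det := Matrix.det_conj_of_mul_eq_one hWW' hWW
  have e5 := congrArg Matrix.det e3
  rw [Matrix.det_mul, e4, e1, e2, Matrix.det_fromBlocks_zero₂₁, Matrix.det_fromBlocks_zero₁₂,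
    Matrix.det_one, Matrix.det_one, one_mul, mul_one] at e5
  exact e5

/-- Completing the square shows that C'MC dominates (C'M⁻¹C)⁻¹. Equality forces C = M⁻¹C(C'M⁻¹C)⁻¹,
that is, the span of C is invariant under M. -/
theorem compress_sub_inv_eq {M : Matrix (Fin q) (Fin q) ℝ} (hM : M.PosDef)
    {C : Matrix (Fin q) (Fin k) ℝ} (hC : IsSemiorthogonal C) :
    (C - M⁻¹ * C * (Cᵀ * M⁻¹ * C)⁻¹)ᵀ * M * (C - M⁻¹ * C * (Cᵀ * M⁻¹ * C)⁻¹) =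
      Cᵀ * M * C - (Cᵀ * M⁻¹ * C)⁻¹ := by
  have hu : IsUnit M.det := hM.det_pos.ne'.isUnit
  have hK := hC.posDef_compress hM.inv
  set K := Cᵀ * M⁻¹ * C with hKdef
  have huK : IsUnit K.det := hK.det_pos.ne'.isUnit
  have hMt : M⁻¹ᵀ = M⁻¹ := by simpa using hM.inv.1.eq
  have hKt : K⁻¹ᵀ = K⁻¹ := by simpa using hK.inv.1.eq
  have hCC : Cᵀ * C = 1 := hC
  have f1 : Cᵀ * M * (M⁻¹ * C * K⁻¹) = K⁻¹ := by
    calc _ = Cᵀ * (M * M⁻¹) * C * K⁻¹ := by simp only [Matrix.mul_assoc]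
      _ = K⁻¹ := by rw [Matrix.mul_nonsing_inv _ hu, Matrix.mul_one, hCC, Matrix.one_mul]
  have f2 : (M⁻¹ * C * K⁻¹)ᵀ * M = K⁻¹ * Cᵀ := by
    rw [Matrix.transpose_mul, Matrix.transpose_mul, hMt, hKt]
    calc _ = K⁻¹ * Cᵀ * (M⁻¹ * M) := by simp only [Matrix.mul_assoc]
      _ = _ := by rw [Matrix.nonsing_inv_mul _ hu, Matrix.mul_one]
  have f3 : K⁻¹ * Cᵀ * (M⁻¹ * C * K⁻¹) = K⁻¹ := by
    calc _ = K⁻¹ * (Cᵀ * M⁻¹ * C) * K⁻¹ := by simp only [Matrix.mul_assoc]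
      _ = K⁻¹ := by rw [← hKdef, Matrix.nonsing_inv_mul _ huK, Matrix.one_mul]
  have f4 : K⁻¹ * Cᵀ * C = K⁻¹ := by rw [Matrix.mul_assoc, hCC, Matrix.mul_one]
  rw [Matrix.transpose_sub, Matrix.sub_mul, f2, Matrix.sub_mul, Matrix.mul_sub, Matrix.mul_sub,
    f1, f3, f4]
  abel

variable {n : Type*} [Fintype n] {M : Matrix (Fin q) (Fin q) ℝ}
  {B : Matrix (Fin q) n ℝ} {N : Matrix n n ℝ}

/-- Jacobi's identity, applied to G and to M, moves both determinants to the complement C. There the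
two remaining matrices are ordered as quadratic forms, for G = M + BNB' with N positive
semidefinite. -/
theorem popObjective_eq_of_complement {G : Matrix (Fin q) (Fin q) ℝ} (hM : M.PosDef)
    (hG : G.PosDef) {D : Matrix (Fin q) (Fin u) ℝ} {C : Matrix (Fin q) (Fin k) ℝ}
    (hD : IsSemiorthogonal D) (hC : IsSemiorthogonal C) (hDC : Dᵀ * C = 0) (hCD : Cᵀ * D = 0)
    (h1 : D * Dᵀ + C * Cᵀ = 1) :
    popObjective M G D = Real.log M.det - Real.log G.det +
      (Real.log (Cᵀ * G * C).det - Real.log (Cᵀ * M⁻¹ * C)⁻¹.det) := by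
  have e1 := det_compress_inv hG.det_pos.ne'.isUnit hD hC hDC hCD h1
  have e2 := det_compress_inv hM.det_pos.ne'.isUnit hC hD hCD hDC (by rw [add_comm]; exact h1)
  have p1 := (hC.posDef_compress hM.inv).det_pos
  have p2 := (hD.posDef_compress hG.inv).det_pos
  rw [popObjective, e1, e2, Real.log_mul hM.det_pos.ne' p1.ne',
    Real.log_mul hG.det_pos.ne' p2.ne', Matrix.det_nonsing_inv, Ring.inverse_eq_inv', Real.log_inv]
  ring

/-- The excess splits into a term measuring how far the span of C is from being invariant under M
and a term measuring how far B is from being orthogonal to C. -/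
theorem complement_form_sub (hM : M.PosDef) {C : Matrix (Fin q) (Fin k) ℝ}
    (hC : IsSemiorthogonal C) (x : Fin k → ℝ) :
    x ⬝ᵥ (Cᵀ * (M + B * N * Bᵀ) * C) *ᵥ x = x ⬝ᵥ (Cᵀ * M⁻¹ * C)⁻¹ *ᵥ x +
      (((C - M⁻¹ * C * (Cᵀ * M⁻¹ * C)⁻¹) *ᵥ x) ⬝ᵥ M *ᵥ
        ((C - M⁻¹ * C * (Cᵀ * M⁻¹ * C)⁻¹) *ᵥ x) +
        ((Bᵀ * C) *ᵥ x) ⬝ᵥ N *ᵥ ((Bᵀ * C) *ᵥ x)) := by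
  rw [← dotProduct_mulVec_compress, ← dotProduct_mulVec_compress, compress_sub_inv_eq hM hC,
    ← dotProduct_add, ← dotProduct_add, ← Matrix.add_mulVec, ← Matrix.add_mulVec]
  congr 2
  rw [Matrix.transpose_mul, Matrix.transpose_transpose, Matrix.mul_add, Matrix.add_mul]
  simp only [Matrix.mul_assoc]
  abel

/-- The lower bound of the population objective function is attained at reducing subspaces
containing the span of `B`. -/
theorem popObjective_of_reducing (hM : M.PosDef) (hN : N.PosDef) {D : Matrix (Fin q) (Fin u) ℝ}
    (hD : IsSemiorthogonal D) (hMD : D * Dᵀ * (M * D) = M * D) (hBD : D * Dᵀ * B = B) :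
    popObjective M (M + B * N * Bᵀ) D = Real.log M.det - Real.log (M + B * N * Bᵀ).det := by
  obtain ⟨k, C, hC, hDC, hCD, h1⟩ := exists_complement hD
  have hG := posDef_add_mul_mul_transpose B hM hN.posSemidef
  have hu : IsUnit M.det := hM.det_pos.ne'.isUnit
  have hMt : Mᵀ = M := by simpa using hM.1.eq
  have hCB : Cᵀ * B = 0 := by
    rw [← hBD, Matrix.mul_assoc, ← Matrix.mul_assoc Cᵀ, hCD, Matrix.zero_mul]
  have hCMD : Cᵀ * M * D = 0 := by
    rw [Matrix.mul_assoc, ← hMD, Matrix.mul_assoc, ← Matrix.mul_assoc Cᵀ, hCD, Matrix.zero_mul]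
  have hDMC : Dᵀ * M * C = 0 := by
    have := congrArg Matrix.transpose hCMD
    simpa [Matrix.transpose_mul, hMt, Matrix.mul_assoc] using this
  have hCGC : Cᵀ * (M + B * N * Bᵀ) * C = Cᵀ * M * C := by
    rw [Matrix.mul_add, ← Matrix.mul_assoc, ← Matrix.mul_assoc, hCB, Matrix.zero_mul,
      Matrix.zero_mul, add_zero]
  have hCMC : C * (Cᵀ * M * C) = M * C := by
    calc C * (Cᵀ * M * C) = D * (Dᵀ * M * C) + C * (Cᵀ * M * C) := by
          rw [hDMC, Matrix.mul_zero, zero_add]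
      _ = (D * Dᵀ + C * Cᵀ) * (M * C) := by
          rw [Matrix.add_mul]; simp only [Matrix.mul_assoc]
      _ = M * C := by rw [h1, Matrix.one_mul]
  have hinv : (Cᵀ * M⁻¹ * C)⁻¹ = Cᵀ * M * C := by
    refine Matrix.inv_eq_right_inv ?_
    rw [Matrix.mul_assoc, hCMC, Matrix.mul_assoc, ← Matrix.mul_assoc M⁻¹,
      Matrix.nonsing_inv_mul _ hu, Matrix.one_mul, show Cᵀ * C = 1 from hC]
  rw [popObjective_eq_of_complement hM hG hD hC hDC hCD h1, hCGC, hinv, sub_self, add_zero]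

/-- Equality in the lower bound forces the subspace to be reducing and to contain the span
of `B`. -/
theorem reducing_of_popObjective_le (hM : M.PosDef) (hN : N.PosDef)
    {D : Matrix (Fin q) (Fin u) ℝ} (hD : IsSemiorthogonal D)
    (hle : popObjective M (M + B * N * Bᵀ) D ≤ Real.log M.det - Real.log (M + B * N * Bᵀ).det) :
    Reduces (colSpan D) M ∧ colSpan B ≤ colSpan D := by
  obtain ⟨k, C, hC, hDC, hCD, h1⟩ := exists_complement hD
  have hG := posDef_add_mul_mul_transpose B hM hN.posSemidef
  have hu : IsUnit M.det := hM.det_pos.ne'.isUnit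
  have hMt : Mᵀ = M := by simpa using hM.1.eq
  have hK := hC.posDef_compress hM.inv
  rw [popObjective_eq_of_complement hM hG hD hC hDC hCD h1] at hle
  have nn1 : ∀ z : Fin q → ℝ, 0 ≤ z ⬝ᵥ M *ᵥ z := fun z => by
    simpa using hM.posSemidef.dotProduct_mulVec_nonneg z
  have nn2 : ∀ z : n → ℝ, 0 ≤ z ⬝ᵥ N *ᵥ z := fun z => by
    simpa using hN.posSemidef.dotProduct_mulVec_nonneg z
  have heq := dotProduct_mulVec_eq_of_log_det_le hK.inv (hC.posDef_compress hG)
    (fun x => by rw [complement_form_sub hM hC]; linarith [nn1 ((C - M⁻¹ * C *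
      (Cᵀ * M⁻¹ * C)⁻¹) *ᵥ x), nn2 ((Bᵀ * C) *ᵥ x)]) (by linarith)
  have hz1 : ∀ z : Fin q → ℝ, z ⬝ᵥ M *ᵥ z = 0 → z = 0 := fun z hz => by
    by_contra hne
    have := hM.dotProduct_mulVec_pos hne
    rw [star_trivial] at this
    exact this.ne' hz
  have hz2 : ∀ z : n → ℝ, z ⬝ᵥ N *ᵥ z = 0 → z = 0 := fun z hz => by
    by_contra hne
    have := hN.dotProduct_mulVec_pos hne
    rw [star_trivial] at this
    exact this.ne' hz
  -- Equality of determinants makes the total excess zero; both of its terms are nonnegative, so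
  -- both vanish on each basis vector, and definiteness of M and N removes the two matrices.
  have hC1 : C - M⁻¹ * C * (Cᵀ * M⁻¹ * C)⁻¹ = 0 := by
    refine Matrix.ext_of_mulVec_single fun j => ?_
    rw [Matrix.zero_mulVec]
    refine hz1 _ ?_
    have := heq (Pi.single j 1)
    rw [complement_form_sub hM hC] at this
    linarith [nn1 ((C - M⁻¹ * C * (Cᵀ * M⁻¹ * C)⁻¹) *ᵥ Pi.single j 1),
      nn2 ((Bᵀ * C) *ᵥ Pi.single j 1)]
  have hC2 : Bᵀ * C = 0 := by
    refine Matrix.ext_of_mulVec_single fun j => ?_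
    rw [Matrix.zero_mulVec]
    refine hz2 _ ?_
    have := heq (Pi.single j 1)
    rw [complement_form_sub hM hC] at this
    linarith [nn1 ((C - M⁻¹ * C * (Cᵀ * M⁻¹ * C)⁻¹) *ᵥ Pi.single j 1),
      nn2 ((Bᵀ * C) *ᵥ Pi.single j 1)]
  have hDMC : Dᵀ * M * C = 0 := by
    calc Dᵀ * M * C = Dᵀ * (M * M⁻¹) * C * (Cᵀ * M⁻¹ * C)⁻¹ := by
          conv_lhs => rw [sub_eq_zero.1 hC1]
          simp only [Matrix.mul_assoc]
      _ = 0 := by rw [Matrix.mul_nonsing_inv _ hu, Matrix.mul_one, hDC, Matrix.zero_mul]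
  have hCMD : Cᵀ * M * D = 0 := by
    have := congrArg Matrix.transpose hDMC
    simpa [Matrix.transpose_mul, hMt, Matrix.mul_assoc] using this
  have hCB : Cᵀ * B = 0 := by
    have := congrArg Matrix.transpose hC2
    simpa [Matrix.transpose_mul] using this
  constructor
  · have hQ : (1 : EuclideanSpace ℝ (Fin q) →L[ℝ] EuclideanSpace ℝ (Fin q)) -
        Matrix.toEuclideanCLM (n := Fin q) (𝕜 := ℝ) (D * Dᵀ) =
        Matrix.toEuclideanCLM (n := Fin q) (𝕜 := ℝ) (C * Cᵀ) := by
      rw [sub_eq_iff_eq_add, ← map_add, add_comm (C * Cᵀ), h1, map_one]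
    rw [Reduces, starProjection_colSpan hD, hQ, ← map_mul, ← map_mul, ← map_mul, ← map_mul,
      ← map_add]
    congr 1
    calc M = (D * Dᵀ + C * Cᵀ) * M * (D * Dᵀ + C * Cᵀ) := by
          rw [h1, Matrix.one_mul, Matrix.mul_one]
      _ = D * Dᵀ * M * (D * Dᵀ) + C * Cᵀ * M * (C * Cᵀ) +
          (D * (Dᵀ * M * C) * Cᵀ + C * (Cᵀ * M * D) * Dᵀ) := by
          simp only [Matrix.add_mul, Matrix.mul_add, Matrix.mul_assoc]
          abel
      _ = _ := by rw [hDMC, hCMD]; simp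
  · rw [colSpan_le_colSpan_iff hD]
    calc D * Dᵀ * B = D * Dᵀ * B + C * (Cᵀ * B) := by rw [hCB, Matrix.mul_zero, add_zero]
      _ = (D * Dᵀ + C * Cᵀ) * B := by rw [Matrix.add_mul, Matrix.mul_assoc C]
      _ = B := by rw [h1, Matrix.one_mul]

/-- The minimizers of the population objective function span the envelope. -/
theorem colSpan_eq_envelope_of_isArgmin (hM : M.PosDef) (hN : N.PosDef)
    (hu : Module.finrank ℝ (envelope M (colSpan B)) = u) {D : Matrix (Fin q) (Fin u) ℝ}
    (hD : IsArgmin (popObjective M (M + B * N * Bᵀ)) D) :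
    colSpan D = envelope M (colSpan B) := by
  obtain ⟨E, hE, hEspan⟩ := exists_semiorthogonal_colSpan_eq (envelope M (colSpan B)) hu
  have h1 : E * Eᵀ * B = B := by
    rw [← colSpan_le_colSpan_iff hE, hEspan]
    exact le_envelope _ _
  have h2 : E * Eᵀ * (M * E) = M * E := by
    rw [← colSpan_le_colSpan_iff hE, hEspan, colSpan, Submodule.span_le, Set.range_subset_iff]
    intro j
    have hj : (WithLp.toLp 2 (fun i => E i j) : EuclideanSpace ℝ (Fin q)) ∈
        envelope M (colSpan B) := by
      rw [← hEspan]
      exact Submodule.subset_span ⟨j, rfl⟩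
    have := envelope_apply_mem hj
    rwa [Matrix.toEuclideanCLM_toLp] at this
  have h3 := hD.2 E hE
  rw [popObjective_of_reducing hM hN hE h2 h1] at h3
  have h4 := reducing_of_popObjective_le hM hN hD.1 h3
  -- The span of `D` is one of the subspaces being intersected, so it contains the envelope; equal
  -- dimensions finish.
  refine (Submodule.eq_of_le_of_finrank_eq (sInf_le h4) ?_).symm
  rw [finrank_colSpan hD.1]
  exact hu

end Population

/-! The companion matrix -/

section Companion

variable {p q : ℕ}

/-- The companion matrix of a vector autoregression. -/
def companion (β : Matrix (Fin q) (Fin p × Fin q) ℝ) :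
    Matrix (Fin p × Fin q) (Fin p × Fin q) ℝ :=
  Matrix.of fun kj li =>
    if kj.1.val = 0 then β kj.2 li else if li.1.val + 1 = kj.1.val ∧ li.2 = kj.2 then 1 else 0

theorem companion_mulVec_zero (β : Matrix (Fin q) (Fin p × Fin q) ℝ) (x : Fin p × Fin q → ℝ)
    {k : Fin p} (hk : k.val = 0) (j : Fin q) : (companion β *ᵥ x) (k, j) = (β *ᵥ x) j := by
  simp [companion, Matrix.mulVec, dotProduct, hk]

/-- The coefficient map is general because the shift rows act both on complex eigenvectors and on
the real state vector. -/
theorem companion_mulVec_succ {𝕜 : Type*} [CommRing 𝕜] (f : ℝ →+* 𝕜)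
    (β : Matrix (Fin q) (Fin p × Fin q) ℝ) (x : Fin p × Fin q → 𝕜)
    {k l : Fin p} (hkl : l.val + 1 = k.val) (j : Fin q) :
    ((companion β).map f *ᵥ x) (k, j) = x (l, j) := by
  have hk : k.val ≠ 0 := by omega
  rw [Matrix.mulVec, dotProduct, Finset.sum_eq_single (l, j)]
  · simp [companion, hk, hkl]
  · rintro ⟨l', i⟩ _ hne
    have : ¬ (l'.val + 1 = k.val ∧ i = j) := fun h => hne (by
      rw [Prod.mk.injEq]; exact ⟨Fin.ext (by omega), h.2⟩)
    simp [companion, hk, this]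
  · simp

/-- The eigenvalues of the companion matrix of a stable autoregression lie in the open unit
disk. -/
theorem norm_lt_one_of_companion_mulVec {β : Matrix (Fin q) (Fin p × Fin q) ℝ}
    (hroots : ∀ z : ℂ, (charMatrix β z).det = 0 → 1 < ‖z‖) {c : ℂ} {v : Fin p × Fin q → ℂ}
    (hv : v ≠ 0) (h : (companion β).map Complex.ofRealHom *ᵥ v = c • v) : ‖c‖ < 1 := by
  by_contra hc
  have hc0 : c ≠ 0 := by
    rintro rfl
    simp at hc
  have hp : 0 < p := by
    rcases Nat.eq_zero_or_pos p with rfl | hp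
    · exact (hv (Subsingleton.elim _ _)).elim
    · exact hp
  -- The shift rows force an eigenvector to have blocks z^k w, and the first block row then says
  -- that w is in the kernel of `charMatrix β z`. The root condition gives ‖z‖ > 1, whereas ‖c‖ ≥ 1
  -- gives ‖z‖ ≤ 1.
  set z := c⁻¹ with hz
  have hzc : z * c = 1 := inv_mul_cancel₀ hc0
  let w : Fin q → ℂ := fun j => v (⟨0, hp⟩, j)
  have hvw : ∀ n : ℕ, ∀ hn : n < p, ∀ j, v (⟨n, hn⟩, j) = z ^ n * w j := by
    intro n
    induction n with
    | zero => intro hn j; simp [w]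
    | succ n ih =>
      intro hn j
      have h1 := congrFun h (⟨n + 1, hn⟩, j)
      rw [companion_mulVec_succ Complex.ofRealHom β v (l := ⟨n, by omega⟩) rfl, ih,
        Pi.smul_apply, smul_eq_mul] at h1
      calc v (⟨n + 1, hn⟩, j) = z * c * v (⟨n + 1, hn⟩, j) := by rw [hzc, one_mul]
        _ = z * (z ^ n * w j) := by rw [mul_assoc, h1]
        _ = z ^ (n + 1) * w j := by ring
  have hw : w ≠ 0 := fun hw => hv (funext fun ⟨⟨n, hn⟩, j⟩ => by rw [hvw, hw]; simp)
  have hker : charMatrix β z *ᵥ w = 0 := by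
    funext j
    have h0 := congrFun h (⟨0, hp⟩, j)
    have h1 : ((companion β).map Complex.ofRealHom *ᵥ v) (⟨0, hp⟩, j) =
        ∑ k : Fin p, ∑ i, (β j (k, i) : ℂ) * (z ^ (k : ℕ) * w i) := by
      rw [Matrix.mulVec, dotProduct, Fintype.sum_prod_type]
      refine Finset.sum_congr rfl fun k _ => Finset.sum_congr rfl fun i _ => ?_
      rw [← hvw k k.2]
      simp [companion]
    rw [h1, Pi.smul_apply, smul_eq_mul] at h0
    have h2 : (charMatrix β z *ᵥ w) j =
        w j - z * ∑ k : Fin p, ∑ i, (β j (k, i) : ℂ) * (z ^ (k : ℕ) * w i) := by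
      rw [charMatrix, Matrix.sub_mulVec, Matrix.one_mulVec, Matrix.sum_mulVec, Pi.sub_apply,
        Finset.sum_apply, Finset.mul_sum]
      congr 1
      refine Finset.sum_congr rfl fun k _ => ?_
      rw [Matrix.smul_mulVec, Pi.smul_apply, smul_eq_mul, Matrix.mulVec, dotProduct,
        Finset.mul_sum, Finset.mul_sum]
      refine Finset.sum_congr rfl fun i _ => ?_
      simp only [Matrix.of_apply]
      ring
    rw [h2, h0, ← mul_assoc, hzc, one_mul, Pi.zero_apply]
    exact sub_self _
  have hdet := Matrix.exists_mulVec_eq_zero_iff.1 ⟨w, hw, hker⟩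
  have h1 := hroots z hdet
  rw [hz, norm_inv] at h1
  have h2 := inv_le_one_of_one_le₀ (not_lt.1 hc)
  linarith

end Companion

/-! ### Decay of powers of stable matrices -/

section Power

attribute [local instance] Matrix.linftyOpNormedRing Matrix.linftyOpNormedAlgebra

/-- Powers of a complex matrix with eigenvalues in the open unit disk tend to zero. -/
theorem tendsto_norm_pow_zero_of_eigenvalues {n : Type*} [Fintype n] [DecidableEq n]
    {A : Matrix n n ℂ} (hA : ∀ (c : ℂ) (v : n → ℂ), v ≠ 0 → A *ᵥ v = c • v → ‖c‖ < 1) :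
    Tendsto (fun k : ℕ => ‖A ^ k‖) atTop (𝓝 0) := by
  rcases isEmpty_or_nonempty n with hn | hn
  · have : ∀ k : ℕ, ‖A ^ k‖ = 0 := fun k => by rw [Subsingleton.elim (A ^ k) 0, norm_zero]
    simp [this]
  have : CompleteSpace (Matrix n n ℂ) := FiniteDimensional.complete ℂ _
  have hspec : ∀ c ∈ spectrum ℂ A, ‖c‖₊ < 1 := by
    intro c hc
    rw [spectrum.mem_iff, Matrix.isUnit_iff_isUnit_det, isUnit_iff_ne_zero, not_not] at hc
    obtain ⟨v, hv, h0⟩ := Matrix.exists_mulVec_eq_zero_iff.2 hc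
    refine hA c v hv ?_
    rw [Matrix.sub_mulVec, sub_eq_zero, Algebra.algebraMap_eq_smul_one, Matrix.smul_mulVec,
      Matrix.one_mulVec] at h0
    exact h0.symm
  -- By Gelfand's formula, any r strictly between the spectral radius and 1 eventually gives ‖A^k‖ ≤
  -- r^k.
  have hrad := spectrum.spectralRadius_lt_of_forall_lt A hspec
  obtain ⟨r, hr1, hr2⟩ := ENNReal.lt_iff_exists_nnreal_btwn.1 hrad
  have hr2' : (r : ℝ) < 1 := by exact_mod_cast hr2
  have hev := (spectrum.pow_nnnorm_pow_one_div_tendsto_nhds_spectralRadius A).eventually_lt_const hr1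
  refine tendsto_of_tendsto_of_tendsto_of_le_of_le' tendsto_const_nhds
    (tendsto_pow_atTop_nhds_zero_of_lt_one r.2 hr2') (Eventually.of_forall fun k => norm_nonneg _) ?_
  filter_upwards [hev, eventually_gt_atTop 0] with k hk hk0
  have hk' : (k : ℝ) ≠ 0 := by exact_mod_cast hk0.ne'
  have h1 := ENNReal.rpow_le_rpow hk.le (Nat.cast_nonneg (α := ℝ) k)
  rw [← ENNReal.rpow_mul, one_div, inv_mul_cancel₀ hk', ENNReal.rpow_one,
    ENNReal.rpow_natCast] at h1
  exact_mod_cast h1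

theorem tendsto_pow_zero_of_eigenvalues {n : Type*} [Fintype n] [DecidableEq n]
    {A : Matrix n n ℝ} (hA : ∀ (c : ℂ) (v : n → ℂ), v ≠ 0 →
      A.map Complex.ofRealHom *ᵥ v = c • v → ‖c‖ < 1) (i j : n) :
    Tendsto (fun k : ℕ => (A ^ k) i j) atTop (𝓝 0) := by
  have h := tendsto_norm_pow_zero_of_eigenvalues hA
  refine squeeze_zero_norm (fun k => ?_) h
  have h1 : (A.map Complex.ofRealHom) ^ k = (A ^ k).map Complex.ofRealHom :=
    (map_pow (Complex.ofRealHom.mapMatrix) A k).symm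
  have h2 : ‖((A.map Complex.ofRealHom) ^ k) i j‖ ≤ ‖(A.map Complex.ofRealHom) ^ k‖ := by
    rw [Matrix.linfty_opNorm_def, ← coe_nnnorm, NNReal.coe_le_coe]
    refine le_trans ?_ (Finset.le_sup (f := fun i => ∑ j, ‖((A.map Complex.ofRealHom) ^ k) i j‖₊)
      (Finset.mem_univ i))
    exact Finset.single_le_sum (f := fun j => ‖((A.map Complex.ofRealHom) ^ k) i j‖₊)
      (fun _ _ => zero_le) (Finset.mem_univ j)
  refine le_trans (le_of_eq ?_) h2
  rw [h1]
  simp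

theorem tendsto_companion_pow {p q : ℕ} {β : Matrix (Fin q) (Fin p × Fin q) ℝ}
    (hroots : ∀ z : ℂ, (charMatrix β z).det = 0 → 1 < ‖z‖) (i j : Fin p × Fin q) :
    Tendsto (fun k : ℕ => (companion β ^ k) i j) atTop (𝓝 0) :=
  tendsto_pow_zero_of_eigenvalues (fun _ _ hv h => norm_lt_one_of_companion_mulVec hroots hv h) i j

end Power

/-! A weak law of large numbers in `L¹` for products of moving averages -/

section MeanErgodic

variable {Ω : Type*} [MeasurableSpace Ω] {P : Measure Ω}

/-- The average over `1, …, T` of the centered variables of a process. -/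
noncomputable def centeredMean (P : Measure Ω) (Z : ℤ → Ω → ℝ) (T : ℕ) : Ω → ℝ :=
  (T : ℝ)⁻¹ • ∑ t ∈ Finset.Icc (1 : ℤ) (T : ℤ), (Z t - fun _ => ∫ ω, Z t ω ∂P)

/-- The averages of a process are in `L¹` asymptotically equal to the averages of the means. -/
def MeanErgodic (P : Measure Ω) (Z : ℤ → Ω → ℝ) : Prop :=
  Tendsto (fun T : ℕ => eLpNorm (centeredMean P Z T) 1 P) atTop (𝓝 0)

variable {Z W : ℤ → Ω → ℝ}

theorem centeredMean_add (hZ : ∀ t, Integrable (Z t) P) (hW : ∀ t, Integrable (W t) P) (T : ℕ) :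
    centeredMean P (Z + W) T = centeredMean P Z T + centeredMean P W T := by
  rw [centeredMean, centeredMean, centeredMean, ← smul_add, ← Finset.sum_add_distrib]
  congr 1
  refine Finset.sum_congr rfl fun t _ => ?_
  funext ω
  have : ∫ ω, (Z + W) t ω ∂P = ∫ ω, Z t ω ∂P + ∫ ω, W t ω ∂P := integral_add (hZ t) (hW t)
  simp only [Pi.sub_apply, Pi.add_apply] at this ⊢
  rw [this]
  ring

theorem MeanErgodic.smul (c : ℝ) (h : MeanErgodic P Z) : MeanErgodic P (c • Z) := by
  have h3 := ENNReal.Tendsto.const_mul (a := ‖c‖ₑ) h (Or.inr enorm_ne_top)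
  rw [mul_zero] at h3
  refine h3.congr fun T => ?_
  rw [← eLpNorm_const_smul]
  congr 1
  rw [centeredMean, centeredMean, smul_comm, Finset.smul_sum]
  congr 1
  refine Finset.sum_congr rfl fun t _ => ?_
  funext ω
  have : ∫ ω, (c • Z) t ω ∂P = c * ∫ ω, Z t ω ∂P := integral_const_mul c _
  simp only [Pi.sub_apply, Pi.smul_apply, smul_eq_mul] at this ⊢
  rw [this]
  ring

theorem MeanErgodic.zero : MeanErgodic P (0 : ℤ → Ω → ℝ) := by
  have : ∀ T, centeredMean P (0 : ℤ → Ω → ℝ) T = 0 := fun T => by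
    rw [centeredMean, Finset.sum_eq_zero, smul_zero]
    intro t _
    funext ω
    simp
  simp [MeanErgodic, this]

theorem sum_Icc_int_eq_sum_range {M : Type*} [AddCommMonoid M] (f : ℤ → M) (T : ℕ) :
    ∑ t ∈ Finset.Icc (1 : ℤ) (T : ℤ), f t = ∑ n ∈ Finset.range T, f (n + 1) := by
  induction T with
  | zero => simp
  | succ T ih =>
    rw [Finset.sum_range_succ, ← ih]
    have : Finset.Icc (1 : ℤ) ((T + 1 : ℕ) : ℤ) =
        insert ((T : ℤ) + 1) (Finset.Icc (1 : ℤ) (T : ℤ)) := by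
      ext x
      simp only [Finset.mem_Icc, Finset.mem_insert]
      push_cast
      omega
    rw [this, Finset.sum_insert (by simp), add_comm]

/-- The law of large numbers for a function of the noise. -/
theorem MeanErgodic.of_iid {E : Type*} [MeasurableSpace E] {X : ℤ → Ω → E} (hX : iIndepFun X P)
    (hid : ∀ t, IdentDistrib (X t) (X 0) P P) {f : E → ℝ} (hf : Measurable f)
    (hint : Integrable (fun ω => f (X 0 ω)) P) (j : ℤ) :
    MeanErgodic P (fun t ω => f (X (t - j) ω)) := by
  let Y : ℕ → Ω → ℝ := fun n ω => f (X ((n : ℤ) + 1 - j) ω)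
  have hidY : ∀ t, IdentDistrib (fun ω => f (X t ω)) (fun ω => f (X 0 ω)) P P := fun t =>
    (hid t).comp hf
  have h0 : ∀ t, ∫ ω, f (X t ω) ∂P = ∫ ω, f (X 0 ω) ∂P := fun t => (hidY t).integral_eq
  have hlaw := strong_law_Lp (p := 1) (μ := P) le_rfl ENNReal.one_ne_top Y
    (memLp_one_iff_integrable.2 ((hidY _).integrable_iff.2 hint))
    (fun m n hmn => by
      have hne : ((m : ℤ) + 1 - j) ≠ (n : ℤ) + 1 - j := by
        have : (m : ℤ) ≠ n := by exact_mod_cast hmn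
        omega
      exact (hX.indepFun hne).comp hf hf)
    (fun n => (hidY _).trans (hidY _).symm)
  refine hlaw.congr' ?_
  filter_upwards [eventually_gt_atTop 0] with T hT
  congr 1
  funext ω
  have hT' : (T : ℝ) ≠ 0 := by exact_mod_cast hT.ne'
  rw [centeredMean, sum_Icc_int_eq_sum_range]
  simp only [Pi.smul_apply, Finset.sum_apply, Pi.sub_apply, smul_eq_mul, h0,
    Finset.sum_sub_distrib, Finset.sum_const, Finset.card_range, nsmul_eq_mul, Y]
  field_simp
  rfl

variable [IsProbabilityMeasure P]

theorem integrable_centeredMean (hZ : ∀ t, Integrable (Z t) P) (T : ℕ) :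
    Integrable (centeredMean P Z T) P :=
  (integrable_finsetSum' _ fun t _ => (hZ t).sub (integrable_const _)).smul _

theorem MeanErgodic.add (hZ : ∀ t, Integrable (Z t) P) (hW : ∀ t, Integrable (W t) P)
    (h1 : MeanErgodic P Z) (h2 : MeanErgodic P W) : MeanErgodic P (Z + W) := by
  have h3 := Tendsto.add h1 h2
  rw [add_zero] at h3
  refine tendsto_of_tendsto_of_tendsto_of_le_of_le tendsto_const_nhds h3 (fun _ => zero_le)
    fun T => ?_
  simp only
  rw [centeredMean_add hZ hW]
  exact eLpNorm_add_le (integrable_centeredMean hZ T).1 (integrable_centeredMean hW T).1 le_rfl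

/-- Each variable and its mean contribute at most δ. For T = 0 the prefactor is 0 by the convention
for inverses. -/
theorem eLpNorm_centeredMean_le (hZ : ∀ t, Integrable (Z t) P) {δ : ℝ≥0∞}
    (h : ∀ t, eLpNorm (Z t) 1 P ≤ δ) (T : ℕ) : eLpNorm (centeredMean P Z T) 1 P ≤ 2 * δ := by
  have h1 : ∀ t, eLpNorm (Z t - fun _ => ∫ ω, Z t ω ∂P) 1 P ≤ 2 * δ := fun t => by
    refine (eLpNorm_sub_le (hZ t).1 aestronglyMeasurable_const le_rfl).trans ?_
    rw [two_mul]
    refine add_le_add (h t) (le_trans ?_ (h t))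
    rw [eLpNorm_const _ one_ne_zero (IsProbabilityMeasure.ne_zero P), measure_univ,
      ENNReal.one_rpow, mul_one, eLpNorm_one_eq_lintegral_enorm]
    exact enorm_integral_le_lintegral_enorm _
  rw [centeredMean, eLpNorm_const_smul]
  rcases Nat.eq_zero_or_pos T with rfl | hT
  · simp
  calc ‖(T : ℝ)⁻¹‖ₑ * eLpNorm (∑ t ∈ Finset.Icc (1 : ℤ) (T : ℤ),
        (Z t - fun _ => ∫ ω, Z t ω ∂P)) 1 P
      ≤ ‖(T : ℝ)⁻¹‖ₑ * ∑ t ∈ Finset.Icc (1 : ℤ) (T : ℤ), 2 * δ := by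
        gcongr
        refine (eLpNorm_sum_le (fun t _ => ((hZ t).sub (integrable_const _)).1) le_rfl).trans ?_
        exact Finset.sum_le_sum fun t _ => h1 t
    _ = (T : ℝ≥0∞)⁻¹ * T * (2 * δ) := by
        have hT' : (0 : ℝ) < T := by exact_mod_cast hT
        rw [Finset.sum_const, Int.card_Icc, nsmul_eq_mul, ← mul_assoc, Real.enorm_eq_ofReal
          (by positivity), ENNReal.ofReal_inv_of_pos hT', ENNReal.ofReal_natCast]
        simp
    _ ≤ 2 * δ := by
        rw [ENNReal.inv_mul_cancel (by exact_mod_cast hT.ne') (ENNReal.natCast_ne_top T), one_mul]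

/-- Approximation uniform in time controls the error of the averages for all T at once; this carries
the law of large numbers from finite moving averages to their limits. -/
theorem MeanErgodic.of_approx (hZ : ∀ t, Integrable (Z t) P)
    (h : ∀ δ : ℝ≥0∞, δ ≠ 0 → ∃ W : ℤ → Ω → ℝ, (∀ t, Integrable (W t) P) ∧ MeanErgodic P W ∧
      ∀ t, eLpNorm (Z t - W t) 1 P ≤ δ) : MeanErgodic P Z := by
  rw [MeanErgodic, ENNReal.tendsto_nhds_zero]
  intro e he
  have he3 : e / 3 ≠ 0 := (ENNReal.div_pos he.ne' (by simp)).ne'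
  obtain ⟨W, hWi, hW, hle⟩ := h (e / 3) he3
  filter_upwards [(ENNReal.tendsto_nhds_zero.1 hW) (e / 3) (pos_iff_ne_zero.2 he3)] with T hT
  have h1 : Z = W + (Z - W) := by abel
  have hi : ∀ t, Integrable ((Z - W) t) P := fun t => (hZ t).sub (hWi t)
  calc eLpNorm (centeredMean P Z T) 1 P
      = eLpNorm (centeredMean P W T + centeredMean P (Z - W) T) 1 P := by
        rw [← centeredMean_add hWi hi, ← h1]
    _ ≤ eLpNorm (centeredMean P W T) 1 P + eLpNorm (centeredMean P (Z - W) T) 1 P :=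
        eLpNorm_add_le (integrable_centeredMean hWi T).1 (integrable_centeredMean hi T).1 le_rfl
    _ ≤ e / 3 + 2 * (e / 3) := add_le_add hT (eLpNorm_centeredMean_le hi hle T)
    _ = e := by rw [two_mul, ← add_assoc, ENNReal.add_thirds]

/-- The law of large numbers for uncorrelated variables with mean zero and bounded variance. -/
theorem MeanErgodic.of_uncorrelated (hZ : ∀ t, MemLp (Z t) 2 P) (h0 : ∀ t, ∫ ω, Z t ω ∂P = 0)
    {C : ℝ} (hC : ∀ t, ∫ ω, Z t ω * Z t ω ∂P = C)
    (h : ∀ s t, s ≠ t → ∫ ω, Z s ω * Z t ω ∂P = 0) : MeanErgodic P Z := by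
  have hmem : ∀ T, MemLp (centeredMean P Z T) 2 P := fun T =>
    (memLp_finsetSum' _ fun t _ => (hZ t).sub (memLp_const _)).const_smul _
  have hcov : ∀ s t, cov[Z s, Z t; P] = if s = t then C else 0 := fun s t => by
    rw [covariance_eq_sub (hZ s) (hZ t), h0, zero_mul, sub_zero]
    split_ifs with hst
    · rw [hst]; exact hC t
    · exact h s t hst
  have hsum : ∀ T : ℕ, centeredMean P Z T =
      (T : ℝ)⁻¹ • ∑ t ∈ Finset.Icc (1 : ℤ) (T : ℤ), Z t := fun T => by
    rw [centeredMean]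
    congr 1
    refine Finset.sum_congr rfl fun t _ => ?_
    funext ω
    simp [h0]
  have hvar : ∀ T : ℕ, 0 < T → ∫ ω, centeredMean P Z T ω ^ 2 ∂P = C / T := fun T hT => by
    have hT' : (T : ℝ) ≠ 0 := by exact_mod_cast hT.ne'
    have hmean : ∫ ω, centeredMean P Z T ω ∂P = 0 := by
      rw [hsum]
      simp only [Pi.smul_apply, Finset.sum_apply]
      rw [integral_smul, integral_finsetSum _ fun t _ => (hZ t).integrable one_le_two]
      simp [h0]
    rw [← variance_of_integral_eq_zero (hmem T).1.aemeasurable hmean, hsum, variance_smul,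
      variance_sum' fun t _ => hZ t]
    simp only [hcov, Finset.sum_ite_eq]
    rw [Finset.sum_congr rfl fun t ht => if_pos ht, Finset.sum_const, Int.card_Icc]
    simp
    field_simp
  have hle : ∀ T : ℕ, 0 < T →
      eLpNorm (centeredMean P Z T) 1 P ≤ ENNReal.ofReal (Real.sqrt (C / T)) := fun T hT => by
    refine (eLpNorm_le_eLpNorm_of_exponent_le one_le_two (hmem T).1).trans_eq ?_
    rw [(hmem T).eLpNorm_eq_integral_rpow_norm two_ne_zero ENNReal.ofNat_ne_top, ← hvar T hT,
      Real.sqrt_eq_rpow]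
    simp
  have hlim : Tendsto (fun T : ℕ => ENNReal.ofReal (Real.sqrt (C / T))) atTop (𝓝 0) := by
    have h1 : Tendsto (fun T : ℕ => C / (T : ℝ)) atTop (𝓝 0) :=
      tendsto_const_nhds.div_atTop tendsto_natCast_atTop_atTop
    have h2 := ENNReal.tendsto_ofReal ((Real.continuous_sqrt.tendsto 0).comp h1)
    simpa using h2
  refine tendsto_of_tendsto_of_tendsto_of_le_of_le' tendsto_const_nhds hlim
    (Eventually.of_forall fun _ => zero_le) ?_
  filter_upwards [eventually_gt_atTop 0] with T hT using hle T hT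

end MeanErgodic

/-! Finite moving averages of the noise and their `L²` limits -/

section MovingAverage

variable {Ω : Type*} {q : ℕ}

/-- The constant process and the lagged coordinates of the noise. -/
def laggedNoise (ε : ℤ → Ω → Fin q → ℝ) : Option (ℕ × Fin q) → ℤ → Ω → ℝ
  | none => fun _ _ => 1
  | some ja => fun t ω => ε (t - ja.1) ω ja.2

/-- Finite moving averages of the noise with a constant term. -/
def finiteMA (ε : ℤ → Ω → Fin q → ℝ) : Submodule ℝ (ℤ → Ω → ℝ) :=
  Submodule.span ℝ (Set.range (laggedNoise ε))

variable {ε : ℤ → Ω → Fin q → ℝ}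

theorem one_mem_finiteMA : (fun _ _ => 1 : ℤ → Ω → ℝ) ∈ finiteMA ε :=
  Submodule.subset_span ⟨none, rfl⟩

theorem const_mem_finiteMA (c : ℝ) : (fun _ _ => c : ℤ → Ω → ℝ) ∈ finiteMA ε := by
  have := (finiteMA ε).smul_mem c one_mem_finiteMA
  convert this using 1
  funext t ω
  simp

theorem noise_mem_finiteMA (j : ℕ) (a : Fin q) : (fun t ω => ε (t - j) ω a) ∈ finiteMA ε :=
  Submodule.subset_span ⟨some (j, a), rfl⟩

theorem lag_mem_finiteMA (k : ℕ) {Z : ℤ → Ω → ℝ} (hZ : Z ∈ finiteMA ε) :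
    (fun t => Z (t - k)) ∈ finiteMA ε := by
  induction hZ using Submodule.span_induction with
  | mem x hx =>
    obtain ⟨_ | ⟨j, a⟩, rfl⟩ := hx
    · exact one_mem_finiteMA
    · have := noise_mem_finiteMA (ε := ε) (k + j) a
      convert this using 4
      simp [laggedNoise]
      congr 1
      ring_nf
  | zero => exact (finiteMA ε).zero_mem
  | add x y _ _ hx hy => exact (finiteMA ε).add_mem hx hy
  | smul c x _ hx => exact (finiteMA ε).smul_mem c hx

variable [MeasurableSpace Ω] {P : Measure Ω}

/-- Uniform `L²` limits of finite moving averages of the noise. -/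
structure IsMALimit (P : Measure Ω) (ε : ℤ → Ω → Fin q → ℝ) (Z : ℤ → Ω → ℝ) : Prop where
  memLp : ∀ t, MemLp (Z t) 2 P
  approx : ∀ δ : ℝ≥0∞, δ ≠ 0 → ∃ W ∈ finiteMA ε, ∀ t, eLpNorm (Z t - W t) 2 P ≤ δ

variable {Sigma : Matrix (Fin q) (Fin q) ℝ}

theorem IsIIDNoise.aemeasurable (h : IsIIDNoise P Sigma ε) (t : ℤ) : AEMeasurable (ε t) P :=
  (h.identDistrib t).aemeasurable_fst

/-- A coordinate of the noise is orthogonal to functions of the noise at other times. -/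
theorem IsIIDNoise.integral_mul_eq_zero (h : IsIIDNoise P Sigma ε) {m : ℤ} {S : Finset ℤ}
    (hm : m ∉ S) {φ : (S → Fin q → ℝ) → ℝ} (hφ : Measurable φ) (a : Fin q) :
    ∫ ω, ε m ω a * φ (fun i => ε i ω) ∂P = 0 := by
  have hind := h.indep.indepFun_finset₀ {m} S (Finset.disjoint_singleton_left.2 hm) h.aemeasurable
  have hf : Measurable fun x : ({m} : Finset ℤ) → Fin q → ℝ => x ⟨m, Finset.mem_singleton_self m⟩ a :=
    by fun_prop
  have hind' := hind.comp hf hφ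
  have hS : AEMeasurable (fun ω (i : S) => ε i ω) P :=
    aemeasurable_pi_lambda _ fun i => h.aemeasurable i
  have := hind'.integral_fun_mul_eq_mul_integral (h.memLp m a).1
    (hφ.comp_aemeasurable hS).aestronglyMeasurable
  refine this.trans ?_
  have h0 : ∫ ω, ε m ω a ∂P = 0 := h.mean_zero m a
  rw [show (∫ ω, ((fun x : ({m} : Finset ℤ) → Fin q → ℝ => x ⟨m, Finset.mem_singleton_self m⟩ a) ∘
    fun ω (i : ({m} : Finset ℤ)) => ε i ω) ω ∂P) = 0 from h0, zero_mul]

theorem IsIIDNoise.integral_mul_mul_mul_eq_zero (h : IsIIDNoise P Sigma ε) {m r s t : ℤ}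
    (hr : m ≠ r) (hs : m ≠ s) (ht : m ≠ t) (a b c d : Fin q) :
    ∫ ω, ε m ω a * (ε r ω b * (ε s ω c * ε t ω d)) ∂P = 0 := by
  have hm : m ∉ ({r, s, t} : Finset ℤ) := by simp [hr, hs, ht]
  exact h.integral_mul_eq_zero hm (φ := fun x => x ⟨r, by simp⟩ b * (x ⟨s, by simp⟩ c *
    x ⟨t, by simp⟩ d)) (by fun_prop) a

theorem IsIIDNoise.integral_noise_mul_noise (h : IsIIDNoise P Sigma ε) {m r : ℤ} (hr : m ≠ r)
    (a b : Fin q) : ∫ ω, ε m ω a * ε r ω b ∂P = 0 := by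
  have hm : m ∉ ({r} : Finset ℤ) := by simp [hr]
  exact h.integral_mul_eq_zero hm (φ := fun x => x ⟨r, by simp⟩ b) (by fun_prop) a

theorem IsMALimit.lag {Z : ℤ → Ω → ℝ} (hZ : IsMALimit P ε Z) (k : ℕ) :
    IsMALimit P ε (fun t => Z (t - k)) := by
  refine ⟨fun t => hZ.memLp _, fun δ hδ => ?_⟩
  obtain ⟨W, hW, hle⟩ := hZ.approx δ hδ
  exact ⟨_, lag_mem_finiteMA k hW, fun t => hle _⟩

theorem eLpNorm_mul_le {f g : Ω → ℝ} (hf : MemLp f 2 P) (hg : MemLp g 2 P) :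
    eLpNorm (f * g) 1 P ≤ eLpNorm f 2 P * eLpNorm g 2 P := by
  have := eLpNorm_smul_le_mul_eLpNorm (p := 2) (q := 2) (r := 1) hg.1 hf.1
  exact this

variable [IsProbabilityMeasure P]

theorem IsIIDNoise.integral_noise_mul_noise_self (h : IsIIDNoise P Sigma ε) (t : ℤ)
    (a b : Fin q) : ∫ ω, ε t ω a * ε t ω b ∂P = Sigma a b := by
  have h1 := congrFun (congrFun (h.cov_eq t) a) b
  rw [covMatrix, Matrix.of_apply, covariance_eq_sub (h.memLp t a) (h.memLp t b), h.mean_zero,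
    zero_mul, sub_zero] at h1
  exact h1

theorem memLp_of_mem_finiteMA (h : IsIIDNoise P Sigma ε) {Z : ℤ → Ω → ℝ}
    (hZ : Z ∈ finiteMA ε) (t : ℤ) : MemLp (Z t) 2 P := by
  induction hZ using Submodule.span_induction with
  | mem x hx =>
    obtain ⟨_ | ⟨j, a⟩, rfl⟩ := hx
    · exact memLp_const 1
    · exact h.memLp _ _
  | zero => exact MemLp.zero
  | add x y _ _ hx hy => exact hx.add hy
  | smul c x _ hx => exact hx.const_smul c

theorem exists_eLpNorm_le_of_mem_finiteMA (h : IsIIDNoise P Sigma ε) {Z : ℤ → Ω → ℝ}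
    (hZ : Z ∈ finiteMA ε) : ∃ C : ℝ≥0∞, C ≠ ⊤ ∧ ∀ t, eLpNorm (Z t) 2 P ≤ C := by
  induction hZ using Submodule.span_induction with
  | mem x hx =>
    obtain ⟨_ | ⟨j, a⟩, rfl⟩ := hx
    · exact ⟨_, (memLp_const (μ := P) (p := 2) (1 : ℝ)).2.ne, fun t => le_rfl⟩
    · refine ⟨_, (h.memLp 0 a).2.ne, fun t => le_of_eq ?_⟩
      have hm : Measurable fun x : Fin q → ℝ => x a := measurable_pi_apply a
      exact ((h.identDistrib (t - j)).comp hm).eLpNorm_eq 2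
  | zero => exact ⟨0, ENNReal.zero_ne_top, fun t => by simp⟩
  | add x y hx' hy' hx hy =>
    obtain ⟨C, hC, hxC⟩ := hx
    obtain ⟨D, hD, hyD⟩ := hy
    refine ⟨C + D, ENNReal.add_ne_top.2 ⟨hC, hD⟩, fun t => ?_⟩
    exact (eLpNorm_add_le (memLp_of_mem_finiteMA h hx' t).1 (memLp_of_mem_finiteMA h hy' t).1
      one_le_two).trans (add_le_add (hxC t) (hyD t))
  | smul c x _ hx =>
    obtain ⟨C, hC, hxC⟩ := hx
    refine ⟨‖c‖ₑ * C, ENNReal.mul_ne_top enorm_ne_top hC, fun t => ?_⟩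
    rw [Pi.smul_apply, eLpNorm_const_smul]
    gcongr
    exact hxC t

theorem integrable_mul_of_mem_finiteMA (h : IsIIDNoise P Sigma ε) {Z W : ℤ → Ω → ℝ}
    (hZ : Z ∈ finiteMA ε) (hW : W ∈ finiteMA ε) (t : ℤ) : Integrable ((Z * W) t) P :=
  (memLp_of_mem_finiteMA h hZ t).integrable_mul (memLp_of_mem_finiteMA h hW t)

/-- At distinct lags independence makes the product square integrable although the noise has only
second moments, and the products at different times are orthogonal. -/
theorem IsIIDNoise.meanErgodic_mul_of_lt (h : IsIIDNoise P Sigma ε) {j k : ℕ} (hjk : j < k)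
    (a b : Fin q) : MeanErgodic P (fun t ω => ε (t - j) ω a * ε (t - k) ω b) := by
  have hsq : ∀ t : ℤ, ∀ a, ∫ ω, ε t ω a * ε t ω a ∂P = Sigma a a := fun t a =>
    h.integral_noise_mul_noise_self t a a
  have hind : ∀ t : ℤ, IndepFun (fun ω => ε (t - j) ω a * ε (t - j) ω a)
      (fun ω => ε (t - k) ω b * ε (t - k) ω b) P := fun t => by
    have hne : t - (j : ℤ) ≠ t - k := by omega
    exact (h.indep.indepFun hne).comp (φ := fun x : Fin q → ℝ => x a * x a)
      (ψ := fun x : Fin q → ℝ => x b * x b) (by fun_prop) (by fun_prop)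
  have hii : ∀ t a, Integrable (fun ω => ε t ω a * ε t ω a) P := fun t a =>
    (h.memLp t a).integrable_mul (h.memLp t a)
  have hrw : ∀ t ω, (ε (t - j) ω a * ε (t - k) ω b) * (ε (t - j) ω a * ε (t - k) ω b) =
      (ε (t - j) ω a * ε (t - j) ω a) * (ε (t - k) ω b * ε (t - k) ω b) := fun t ω => by ring
  refine MeanErgodic.of_uncorrelated (C := Sigma a a * Sigma b b) (fun t => ?_) (fun t => ?_)
    (fun t => ?_) fun s t hst => ?_
  · refine (memLp_two_iff_integrable_sq ((h.memLp _ a).1.mul (h.memLp _ b).1)).2 ?_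
    have := (hind t).integrable_mul (hii _ a) (hii _ b)
    refine this.congr (Eventually.of_forall fun ω => ?_)
    simp only [Pi.mul_apply, sq]
    exact (hrw t ω).symm
  · exact h.integral_noise_mul_noise (by omega) a b
  · simp only [hrw]
    rw [(hind t).integral_fun_mul_eq_mul_integral (hii _ a).1 (hii _ b).1, hsq, hsq]
  -- Of the four time points the latest is t - j or s - j, and it occurs only once, so that noise
  -- factor is independent of the other three and has mean zero.
  · rcases lt_or_gt_of_ne hst with hlt | hlt
    · rw [← h.integral_mul_mul_mul_eq_zero (m := t - j) (r := s - j) (s := s - k) (t := t - k)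
        (by omega) (by omega) (by omega) a a b b]
      exact integral_congr_ae (Eventually.of_forall fun ω => by simp only; ring)
    · rw [← h.integral_mul_mul_mul_eq_zero (m := s - j) (r := s - k) (s := t - j) (t := t - k)
        (by omega) (by omega) (by omega) a b a b]
      exact integral_congr_ae (Eventually.of_forall fun ω => by simp only; ring)

/-- At equal lags the product is an integrable function of a single noise vector, so the L¹ form of
the strong law applies without fourth moments. -/
theorem IsIIDNoise.meanErgodic_laggedNoise_mul (h : IsIIDNoise P Sigma ε)
    (r s : Option (ℕ × Fin q)) : MeanErgodic P (laggedNoise ε r * laggedNoise ε s) := by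
  have hone : ∀ ja : ℕ × Fin q, MeanErgodic P (laggedNoise ε (some ja)) := fun ja =>
    MeanErgodic.of_iid (f := fun x : Fin q → ℝ => x ja.2) h.indep h.identDistrib
      (measurable_pi_apply _) ((h.memLp 0 ja.2).integrable one_le_two) ja.1
  have hone' : laggedNoise ε none = 1 := rfl
  rcases r with _ | ⟨j, a⟩ <;> rcases s with _ | ⟨k, b⟩
  · rw [hone', one_mul, MeanErgodic]
    have : ∀ T, centeredMean P (1 : ℤ → Ω → ℝ) T = 0 := fun T => by
      rw [centeredMean, Finset.sum_eq_zero, smul_zero]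
      intro t _
      funext ω
      simp
    simp [this]
  · rw [hone', one_mul]
    exact hone _
  · rw [hone', mul_one]
    exact hone _
  · rcases lt_trichotomy j k with hjk | rfl | hjk
    · exact h.meanErgodic_mul_of_lt hjk a b
    · exact MeanErgodic.of_iid (f := fun x : Fin q → ℝ => x a * x b) h.indep h.identDistrib
        (by fun_prop) ((h.memLp 0 a).integrable_mul (h.memLp 0 b)) j
    · rw [mul_comm]
      exact h.meanErgodic_mul_of_lt hjk b a

theorem meanErgodic_mul_of_mem_finiteMA (h : IsIIDNoise P Sigma ε) {Z W : ℤ → Ω → ℝ}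
    (hZ : Z ∈ finiteMA ε) (hW : W ∈ finiteMA ε) : MeanErgodic P (Z * W) := by
  induction hZ, hW using Submodule.span_induction₂ with
  | mem_mem x y hx hy =>
    obtain ⟨r, rfl⟩ := hx
    obtain ⟨s, rfl⟩ := hy
    exact h.meanErgodic_laggedNoise_mul r s
  | zero_left y hy => rw [zero_mul]; exact MeanErgodic.zero
  | zero_right x hx => rw [mul_zero]; exact MeanErgodic.zero
  | add_left x y z hx hy hz h1 h2 =>
    rw [add_mul]
    exact h1.add (integrable_mul_of_mem_finiteMA h hx hz)
      (integrable_mul_of_mem_finiteMA h hy hz) h2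
  | add_right x y z hx hy hz h1 h2 =>
    rw [mul_add]
    exact h1.add (integrable_mul_of_mem_finiteMA h hx hy)
      (integrable_mul_of_mem_finiteMA h hx hz) h2
  | smul_left c x y hx hy h1 => rw [smul_mul_assoc]; exact h1.smul c
  | smul_right c x y hx hy h1 => rw [mul_smul_comm]; exact h1.smul c

theorem IsMALimit.of_mem (h : IsIIDNoise P Sigma ε) {Z : ℤ → Ω → ℝ} (hZ : Z ∈ finiteMA ε) :
    IsMALimit P ε Z :=
  ⟨memLp_of_mem_finiteMA h hZ, fun δ _ => ⟨Z, hZ, fun t => by simp⟩⟩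

theorem IsMALimit.exists_eLpNorm_le (h : IsIIDNoise P Sigma ε) {Z : ℤ → Ω → ℝ}
    (hZ : IsMALimit P ε Z) : ∃ C : ℝ≥0∞, C ≠ ⊤ ∧ ∀ t, eLpNorm (Z t) 2 P ≤ C := by
  obtain ⟨W, hW, hle⟩ := hZ.approx 1 one_ne_zero
  obtain ⟨C, hC, hWC⟩ := exists_eLpNorm_le_of_mem_finiteMA h hW
  refine ⟨1 + C, ENNReal.add_ne_top.2 ⟨ENNReal.one_ne_top, hC⟩, fun t => ?_⟩
  have hWt := memLp_of_mem_finiteMA h hW t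
  calc eLpNorm (Z t) 2 P = eLpNorm ((Z t - W t) + W t) 2 P := by rw [sub_add_cancel]
    _ ≤ eLpNorm (Z t - W t) 2 P + eLpNorm (W t) 2 P :=
        eLpNorm_add_le ((hZ.memLp t).sub hWt).1 hWt.1 one_le_two
    _ ≤ 1 + C := add_le_add (hle t) (hWC t)

/-- Products of limits of moving averages obey the law of large numbers. -/
theorem IsMALimit.meanErgodic_mul (h : IsIIDNoise P Sigma ε) {Z W : ℤ → Ω → ℝ}
    (hZ : IsMALimit P ε Z) (hW : IsMALimit P ε W) : MeanErgodic P (Z * W) := by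
  -- One factor is replaced by a finite moving average at a time, the error being bounded by
  -- Cauchy-Schwarz. The tolerance `δ / C` also works for `C = 0`, where it is ⊤.
  have key : ∀ {U V : ℤ → Ω → ℝ}, (∀ t, MemLp (U t) 2 P) → IsMALimit P ε V →
      (∃ C : ℝ≥0∞, C ≠ ⊤ ∧ ∀ t, eLpNorm (U t) 2 P ≤ C) →
      (∀ V' ∈ finiteMA ε, MeanErgodic P (U * V')) → MeanErgodic P (U * V) := by
    intro U V hU hV hUC hUV
    obtain ⟨C, hC, hUC⟩ := hUC
    refine MeanErgodic.of_approx (fun t => (hU t).integrable_mul (hV.memLp t)) fun δ hδ => ?_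
    obtain ⟨V', hV', hle⟩ := hV.approx (δ / C) (ENNReal.div_ne_zero.2 ⟨hδ, hC⟩)
    have hV't := memLp_of_mem_finiteMA h hV'
    refine ⟨U * V', fun t => (hU t).integrable_mul (hV't t), hUV V' hV', fun t => ?_⟩
    calc eLpNorm ((U * V) t - (U * V') t) 1 P = eLpNorm (U t * (V t - V' t)) 1 P := by
          rw [mul_sub]; rfl
      _ ≤ eLpNorm (U t) 2 P * eLpNorm (V t - V' t) 2 P :=
          eLpNorm_mul_le (hU t) ((hV.memLp t).sub (hV't t))
      _ ≤ C * (δ / C) := mul_le_mul' (hUC t) (hle t)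
      _ ≤ δ := ENNReal.mul_div_le
  refine key hZ.memLp hW (hZ.exists_eLpNorm_le h) fun W' hW' => ?_
  rw [mul_comm]
  refine key (memLp_of_mem_finiteMA h hW') hZ (exists_eLpNorm_le_of_mem_finiteMA h hW')
    fun Z' hZ' => ?_
  exact meanErgodic_mul_of_mem_finiteMA h hW' hZ'

theorem IsMALimit.meanErgodic (h : IsIIDNoise P Sigma ε) {Z : ℤ → Ω → ℝ}
    (hZ : IsMALimit P ε Z) : MeanErgodic P Z := by
  have := hZ.meanErgodic_mul h (IsMALimit.of_mem h one_mem_finiteMA)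
  rwa [show (fun _ _ => 1 : ℤ → Ω → ℝ) = 1 from rfl, mul_one] at this

/-- The noise is orthogonal to the past of a moving average. -/
theorem integral_noise_mul_of_mem_finiteMA (h : IsIIDNoise P Sigma ε) {Z : ℤ → Ω → ℝ}
    (hZ : Z ∈ finiteMA ε) {s t : ℤ} (hst : s < t) (a : Fin q) :
    ∫ ω, ε t ω a * Z s ω ∂P = 0 := by
  induction hZ using Submodule.span_induction with
  | mem x hx =>
    obtain ⟨_ | ⟨j, b⟩, rfl⟩ := hx
    · simpa [laggedNoise] using h.mean_zero t a
    · exact h.integral_noise_mul_noise (by omega) a b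
  | zero => simp
  | add x y hx' hy' hx hy =>
    have hi : ∀ z ∈ finiteMA ε, Integrable (fun ω => ε t ω a * z s ω) P := fun z hz =>
      (h.memLp t a).integrable_mul (memLp_of_mem_finiteMA h hz s)
    simp only [Pi.add_apply, mul_add]
    rw [integral_add (hi x hx') (hi y hy'), hx, hy, add_zero]
  | smul c x _ hx =>
    simp only [Pi.smul_apply, smul_eq_mul, mul_left_comm _ c]
    rw [integral_const_mul, hx, mul_zero]

theorem IsMALimit.integral_noise_mul (h : IsIIDNoise P Sigma ε) {Z : ℤ → Ω → ℝ}
    (hZ : IsMALimit P ε Z) {s t : ℤ} (hst : s < t) (a : Fin q) :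
    ∫ ω, ε t ω a * Z s ω ∂P = 0 := by
  have hεt := h.memLp t a
  rw [← enorm_eq_zero, ← nonpos_iff_eq_zero]
  refine le_of_forall_pos_le_add fun δ hδ => ?_
  rw [zero_add]
  obtain ⟨W, hW, hle⟩ := hZ.approx (δ / eLpNorm (fun ω => ε t ω a) 2 P)
    (ENNReal.div_ne_zero.2 ⟨hδ.ne', hεt.2.ne⟩)
  have hWs := memLp_of_mem_finiteMA h hW s
  have h1 : ∫ ω, ε t ω a * Z s ω ∂P = ∫ ω, ((fun ω => ε t ω a) * (Z s - W s)) ω ∂P := by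
    have : ∀ ω, ((fun ω => ε t ω a) * (Z s - W s)) ω = ε t ω a * Z s ω - ε t ω a * W s ω :=
      fun ω => mul_sub _ _ _
    have hi1 : Integrable (fun ω => ε t ω a * Z s ω) P := hεt.integrable_mul (hZ.memLp s)
    have hi2 : Integrable (fun ω => ε t ω a * W s ω) P := hεt.integrable_mul hWs
    simp only [this]
    rw [integral_sub hi1 hi2,
      integral_noise_mul_of_mem_finiteMA h hW hst, sub_zero]
  rw [h1]
  calc ‖∫ ω, ((fun ω => ε t ω a) * (Z s - W s)) ω ∂P‖ₑ
      ≤ eLpNorm ((fun ω => ε t ω a) * (Z s - W s)) 1 P := by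
        rw [eLpNorm_one_eq_lintegral_enorm]
        exact enorm_integral_le_lintegral_enorm _
    _ ≤ eLpNorm (fun ω => ε t ω a) 2 P * eLpNorm (Z s - W s) 2 P :=
        eLpNorm_mul_le hεt ((hZ.memLp s).sub hWs)
    _ ≤ eLpNorm (fun ω => ε t ω a) 2 P * (δ / eLpNorm (fun ω => ε t ω a) 2 P) :=
        mul_le_mul' le_rfl (hle s)
    _ ≤ δ := ENNReal.mul_div_le

end MovingAverage

/-! Stationary autoregressions as limits of moving averages -/

section Autoregression

variable {Ω : Type*} {p q : ℕ} {α : Fin q → ℝ} {β : Matrix (Fin q) (Fin p × Fin q) ℝ}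
  {Sigma : Matrix (Fin q) (Fin q) ℝ} {ε y : ℤ → Ω → Fin q → ℝ}

/-- The embedding of a vector into the first block. -/
def firstBlock (x : Fin q → ℝ) : Fin p × Fin q → ℝ :=
  fun kj => if kj.1.val = 0 then x kj.2 else 0

/-- The state equation of the autoregression. -/
theorem lagVec_succ {y : ℤ → Fin q → ℝ} {t : ℤ} {e : Fin q → ℝ}
    (h : y t = α + β *ᵥ lagVec p y t + e) :
    lagVec p y (t + 1) = firstBlock (α + e) + companion β *ᵥ lagVec p y t := by
  funext ⟨k, j⟩
  rw [Pi.add_apply]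
  by_cases hk : k.val = 0
  · rw [companion_mulVec_zero β _ hk]
    have : lagVec p y (t + 1) (k, j) = y t j := by simp [lagVec, hk]
    rw [this, h]
    simp [firstBlock, hk]
    ring
  · obtain ⟨l, hl⟩ := Nat.exists_eq_succ_of_ne_zero hk
    have hlp : l < p := by have := k.2; omega
    have := companion_mulVec_succ (RingHom.id ℝ) β (lagVec p y t) (k := k) (l := ⟨l, hlp⟩)
      (by simp [hl]) j
    rw [RingHom.coe_id, Matrix.map_id] at this
    rw [this]
    simp only [lagVec, firstBlock, hk, if_false, zero_add]
    congr 1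
    rw [hl]
    push_cast
    ring

theorem firstBlock_mem_finiteMA (α : Fin q → ℝ) (n : ℕ) (l : Fin p × Fin q) :
    (fun t ω => firstBlock (α + ε (t - n) ω) l) ∈ finiteMA ε := by
  by_cases hl : l.1.val = 0
  · have := (finiteMA ε).add_mem (const_mem_finiteMA (α l.2)) (noise_mem_finiteMA n l.2)
    convert this using 1
    funext t ω
    simp [firstBlock, hl]
  · convert (finiteMA ε).zero_mem using 1
    funext t ω
    simp [firstBlock, hl]

variable [MeasurableSpace Ω] {P : Measure Ω}

theorem covariance_congr_ae {X X' Y Y' : Ω → ℝ} (hX : X =ᵐ[P] X') (hY : Y =ᵐ[P] Y') :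
    cov[X, Y; P] = cov[X', Y'; P] := by
  unfold covariance
  rw [integral_congr_ae hX, integral_congr_ae hY]
  refine integral_congr_ae ?_
  filter_upwards [hX, hY] with ω h1 h2
  rw [h1, h2]

/-- Substituting the state equation n times leaves the remainder βAⁿx_{t-n}, with A the companion
matrix. One process `Z` serves all t, as uniform approximation requires. -/
theorem IsStationaryVAR.exists_finiteMA_add (h : IsStationaryVAR P α β Sigma ε y) (n : ℕ)
    (i : Fin q) : ∃ Z ∈ finiteMA ε, ∀ t, ∀ᵐ ω ∂P, y t ω i =
      Z t ω + ((β * companion β ^ n) *ᵥ lagVec p (fun s => y s ω) (t - n)) i := by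
  induction n with
  | zero =>
    refine ⟨(fun _ _ => α i) + (fun t ω => ε (t - (0 : ℕ)) ω i),
      (finiteMA ε).add_mem (const_mem_finiteMA _) (noise_mem_finiteMA 0 i), fun t => ?_⟩
    filter_upwards [h.equation t] with ω hω
    rw [hω]
    simp
    ring
  | succ n ih =>
    obtain ⟨Z, hZ, hle⟩ := ih
    refine ⟨Z + ∑ l, (β * companion β ^ n) i l •
      (fun t ω => firstBlock (α + ε (t - (n + 1 : ℕ)) ω) l),
      (finiteMA ε).add_mem hZ (Submodule.sum_mem _ fun l _ =>
        (finiteMA ε).smul_mem _ (firstBlock_mem_finiteMA α (n + 1) l)), fun t => ?_⟩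
    filter_upwards [hle t, h.equation (t - (n + 1 : ℕ))] with ω h1 h2
    have h3 := lagVec_succ (β := β) (y := fun s => y s ω) h2
    have h4 : t - ((n + 1 : ℕ) : ℤ) + 1 = t - n := by push_cast; ring
    rw [h4] at h3
    rw [h1, h3, Matrix.mulVec_add, Matrix.mulVec_mulVec, pow_succ, ← Matrix.mul_assoc,
      Pi.add_apply, ← add_assoc]
    congr 1
    simp only [Pi.add_apply, Finset.sum_apply, Pi.smul_apply, smul_eq_mul]
    rfl

theorem IsStationary.integral_mul_eq [IsProbabilityMeasure P] (h : IsStationary P y)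
    (s t : ℤ) (i j : Fin q) (r : ℤ) :
    ∫ ω, y (s + r) ω i * y (t + r) ω j ∂P = ∫ ω, y s ω i * y t ω j ∂P := by
  have h1 := congrFun (congrFun (h.cov_eq s t r) i) j
  simp only [covMatrix, Matrix.of_apply] at h1
  rw [covariance_eq_sub (h.memLp _ i) (h.memLp _ j), covariance_eq_sub (h.memLp _ i) (h.memLp _ j),
    h.mean_eq (s + r), h.mean_eq (t + r), h.mean_eq s, h.mean_eq t, sub_left_inj] at h1
  exact h1

theorem IsStationary.eLpNorm_eq [IsProbabilityMeasure P] (h : IsStationary P y) (t : ℤ)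
    (i : Fin q) : eLpNorm (fun ω => y t ω i) 2 P = eLpNorm (fun ω => y 0 ω i) 2 P := by
  rw [(h.memLp t i).eLpNorm_eq_integral_rpow_norm two_ne_zero ENNReal.ofNat_ne_top,
    (h.memLp 0 i).eLpNorm_eq_integral_rpow_norm two_ne_zero ENNReal.ofNat_ne_top]
  have := h.integral_mul_eq 0 0 i i t
  simp only [zero_add, ← sq] at this
  simp [this]

theorem covMatrix_transpose {m n : Type*} (X : Ω → m → ℝ) (Y : Ω → n → ℝ) :
    (covMatrix P X Y)ᵀ = covMatrix P Y X := by
  ext i j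
  simp only [covMatrix, Matrix.transpose_apply, Matrix.of_apply]
  exact covariance_comm _ _

theorem IsStationaryVAR.memLp_lagVec (h : IsStationaryVAR P α β Sigma ε y) (t : ℤ)
    (l : Fin p × Fin q) : MemLp (fun ω => lagVec p (fun s => y s ω) t l) 2 P :=
  h.stationary.memLp _ _

variable [IsProbabilityMeasure P]

/-- The coordinates of a stationary autoregression are limits of moving averages of the noise. -/
theorem IsStationaryVAR.isMALimit (h : IsStationaryVAR P α β Sigma ε y) (i : Fin q) :
    IsMALimit P ε (fun t ω => y t ω i) := by
  refine ⟨fun t => h.stationary.memLp t i, fun δ hδ => ?_⟩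
  let C : Fin q → ℝ≥0∞ := fun j => eLpNorm (fun ω => y 0 ω j) 2 P
  -- This sum bounds the L² norm of the remainder. By stationarity it does not depend on t.
  have hlim : Tendsto (fun n : ℕ => ∑ l : Fin p × Fin q,
      ‖(β * companion β ^ n) i l‖ₑ * C l.2) atTop (𝓝 0) := by
    have h0 : ∀ l, Tendsto (fun n : ℕ => (β * companion β ^ n) i l) atTop (𝓝 0) := fun l => by
      have := tendsto_finsetSum Finset.univ fun k (_ : k ∈ Finset.univ) =>
        (tendsto_companion_pow h.roots k l).const_mul (β i k)
      simpa [Matrix.mul_apply] using this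
    have h1 : ∀ l : Fin p × Fin q, Tendsto (fun n : ℕ =>
        ‖(β * companion β ^ n) i l‖ₑ * C l.2) atTop (𝓝 0) := fun l => by
      have := ENNReal.Tendsto.mul_const (b := C l.2) (h0 l).enorm
        (Or.inr (h.stationary.memLp 0 l.2).2.ne)
      simpa using this
    have := tendsto_finsetSum Finset.univ fun l (_ : l ∈ Finset.univ) => h1 l
    simpa using this
  obtain ⟨n, hn⟩ := ((ENNReal.tendsto_nhds_zero.1 hlim) δ (pos_iff_ne_zero.2 hδ)).exists
  obtain ⟨Z, hZ, hle⟩ := h.exists_finiteMA_add n i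
  refine ⟨Z, hZ, fun t => le_trans ?_ hn⟩
  let R : Fin p × Fin q → Ω → ℝ := fun l ω => y (t - n - 1 - (l.1 : ℤ)) ω l.2
  have hae : ((fun ω => y t ω i) - Z t) =ᵐ[P] ∑ l, (β * companion β ^ n) i l • R l := by
    filter_upwards [hle t] with ω hω
    rw [Pi.sub_apply, hω, add_sub_cancel_left, Finset.sum_apply]
    rfl
  rw [eLpNorm_congr_ae hae]
  refine (eLpNorm_sum_le (fun l _ => ((h.stationary.memLp _ _).const_smul _).1)
    one_le_two).trans (Finset.sum_le_sum fun l _ => ?_)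
  rw [eLpNorm_const_smul, h.stationary.eLpNorm_eq]

/-- Causality is not assumed in the model: it follows because y_s is a limit of moving averages of
the noise up to time s. -/
theorem IsStationaryVAR.covariance_noise_of_lt (h : IsStationaryVAR P α β Sigma ε y) {s t : ℤ}
    (hst : s < t) (a b : Fin q) : cov[fun ω => ε t ω a, fun ω => y s ω b; P] = 0 := by
  rw [covariance_eq_sub (h.noise.memLp t a) (h.stationary.memLp s b), h.noise.mean_zero, zero_mul,
    sub_zero]
  exact (h.isMALimit b).integral_noise_mul h.noise hst a

/-- The covariances of the autoregression with a square integrable variable. -/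
theorem IsStationaryVAR.covariance_eq (h : IsStationaryVAR P α β Sigma ε y) {U : Ω → ℝ}
    (hU : MemLp U 2 P) (t : ℤ) (i : Fin q) :
    cov[U, fun ω => y t ω i; P] =
      ∑ l, β i l * cov[U, fun ω => lagVec p (fun s => y s ω) t l; P] +
        cov[U, fun ω => ε t ω i; P] := by
  have hae : (fun ω => y t ω i) =ᵐ[P] fun ω => α i +
      ((fun ω => ∑ l, β i l * lagVec p (fun s => y s ω) t l) + fun ω => ε t ω i) ω := by
    filter_upwards [h.equation t] with ω hω
    rw [hω]
    simp only [Pi.add_apply, Matrix.mulVec, dotProduct]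
    ring
  have hl : ∀ l, MemLp (fun ω => β i l * lagVec p (fun s => y s ω) t l) 2 P := fun l =>
    (h.memLp_lagVec t l).const_mul _
  have hs : MemLp (fun ω => ∑ l, β i l * lagVec p (fun s => y s ω) t l) 2 P :=
    memLp_finsetSum _ fun l _ => hl l
  rw [covariance_congr_ae (ae_eq_refl U) hae,
    covariance_const_add_right ((hs.add (h.noise.memLp t i)).integrable one_le_two),
    covariance_add_right hU hs (h.noise.memLp t i), covariance_fun_sum_right hl hU]
  simp only [covariance_const_mul_right]

theorem IsStationaryVAR.covariance_noise_self (h : IsStationaryVAR P α β Sigma ε y) (t : ℤ)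
    (a b : Fin q) : cov[fun ω => ε t ω a, fun ω => y t ω b; P] = Sigma a b := by
  rw [h.covariance_eq (h.noise.memLp t a), Finset.sum_eq_zero, zero_add]
  · exact congrFun (congrFun (h.noise.cov_eq t) a) b
  · intro l _
    have := h.covariance_noise_of_lt (s := t - 1 - (l.1 : ℤ)) (t := t) (by omega) a l.2
    rw [show cov[fun ω => ε t ω a, fun ω => lagVec p (fun s => y s ω) t l; P] = 0 from this,
      mul_zero]

/-- The covariance matrix of the lagged vector. -/
noncomputable def lagCov (P : Measure Ω) (p : ℕ) (y : ℤ → Ω → Fin q → ℝ) :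
    Matrix (Fin p × Fin q) (Fin p × Fin q) ℝ :=
  covMatrix P (fun ω => lagVec p (fun s => y s ω) 0) (fun ω => lagVec p (fun s => y s ω) 0)

/-- The Yule-Walker equation: the noise is uncorrelated with the lagged vector. -/
theorem IsStationaryVAR.covMatrix_lagVec (h : IsStationaryVAR P α β Sigma ε y) :
    covMatrix P (fun ω => lagVec p (fun s => y s ω) 0) (y 0) = lagCov P p y * βᵀ := by
  ext k i
  rw [covMatrix, Matrix.of_apply, h.covariance_eq (h.memLp_lagVec 0 k)]
  have h0 : cov[fun ω => lagVec p (fun s => y s ω) 0 k, fun ω => ε 0 ω i; P] = 0 := by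
    rw [covariance_comm]
    exact h.covariance_noise_of_lt (s := 0 - 1 - (k.1 : ℤ)) (t := 0) (by omega) i k.2
  rw [h0, add_zero, Matrix.mul_apply]
  refine Finset.sum_congr rfl fun l _ => ?_
  rw [Matrix.transpose_apply, mul_comm]
  rfl

theorem IsStationaryVAR.covMatrix_eq (h : IsStationaryVAR P α β Sigma ε y) :
    covMatrix P (y 0) (y 0) = Sigma + β * lagCov P p y * βᵀ := by
  have h1 := congrArg Matrix.transpose h.covMatrix_lagVec
  rw [covMatrix_transpose, Matrix.transpose_mul, Matrix.transpose_transpose, lagCov,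
    covMatrix_transpose] at h1
  ext i j
  rw [covMatrix, Matrix.of_apply, h.covariance_eq (h.stationary.memLp 0 i), add_comm,
    Matrix.add_apply]
  congr 1
  · have h2 := h.covariance_noise_self 0 j i
    have h3 := congrFun (congrFun (h.noise.cov_eq 0) i) j
    have h4 := congrFun (congrFun (h.noise.cov_eq 0) j) i
    rw [covariance_comm, h2, ← h3, ← h4]
    simp only [covMatrix, Matrix.of_apply]
    exact covariance_comm _ _
  · rw [lagCov, ← h1, Matrix.mul_apply]
    refine Finset.sum_congr rfl fun l _ => ?_
    rw [Matrix.transpose_apply, mul_comm]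
    rfl

theorem dotProduct_covMatrix_mulVec {n : Type*} [Fintype n] {X : Ω → n → ℝ}
    (hX : ∀ i, MemLp (fun ω => X ω i) 2 P) (x : n → ℝ) :
    x ⬝ᵥ covMatrix P X X *ᵥ x = Var[fun ω => ∑ i, x i * X ω i; P] := by
  have hl : ∀ i, MemLp (fun ω => x i * X ω i) 2 P := fun i => (hX i).const_mul _
  rw [variance_fun_sum hl]
  simp only [dotProduct, Matrix.mulVec, Finset.mul_sum, covariance_const_mul_left,
    covariance_const_mul_right]
  refine Finset.sum_congr rfl fun i _ => Finset.sum_congr rfl fun j _ => ?_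
  rw [covMatrix, Matrix.of_apply]
  ring

/-- The covariance matrix of the lagged vector is positive definite. -/
theorem IsStationaryVAR.posDef_lagCov (h : IsStationaryVAR P α β Sigma ε y)
    (hSigma : Sigma.PosDef) : (lagCov P p y).PosDef := by
  have hherm : (lagCov P p y).IsHermitian := by
    rw [Matrix.IsHermitian, Matrix.conjTranspose_eq_transpose_of_trivial, lagCov,
      covMatrix_transpose]
  refine Matrix.PosDef.of_dotProduct_mulVec_pos hherm fun x hx => ?_
  rw [star_trivial, lagCov, dotProduct_covMatrix_mulVec (h.memLp_lagVec 0)]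
  refine lt_of_le_of_ne (variance_nonneg _ _) fun hvar => hx ?_
  have hl : ∀ l, MemLp (fun ω => x l * lagVec p (fun s => y s ω) 0 l) 2 P := fun l =>
    (h.memLp_lagVec 0 l).const_mul _
  have hsum : MemLp (fun ω => ∑ l, x l * lagVec p (fun s => y s ω) 0 l) 2 P :=
    memLp_finsetSum _ fun l _ => hl l
  have hconst := ae_eq_integral_of_variance_eq_zero hsum hvar.symm
  -- A combination of the lags with variance zero is almost surely constant, hence uncorrelated with
  -- every square integrable variable.
  have hcov : ∀ U : Ω → ℝ, MemLp U 2 P →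
      ∑ l, x l * cov[U, fun ω => lagVec p (fun s => y s ω) 0 l; P] = 0 := fun U hU => by
    have h1 := covariance_fun_sum_right hl hU
    simp only [covariance_const_mul_right] at h1
    rw [← h1, covariance_congr_ae (ae_eq_refl U) hconst, covariance_const_right]
  -- Test against the noise at time -1-n. Blocks before n have zero coefficients by induction,
  -- blocks after n lie in the past of that noise, and what remains is Σv = 0 for the n-th block v.
  have key : ∀ n : ℕ, ∀ hn : n < p, ∀ j, x (⟨n, hn⟩, j) = 0 := by
    intro n
    induction n using Nat.strong_induction_on with
    | _ n ih =>
      intro hn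
      let v : Fin q → ℝ := fun j => x (⟨n, hn⟩, j)
      have hzero : ∀ a, (Sigma *ᵥ v) a = 0 := fun a => by
        have h1 := hcov (fun ω => ε (0 - 1 - (n : ℤ)) ω a) (h.noise.memLp _ a)
        rw [Fintype.sum_prod_type, Finset.sum_eq_single ⟨n, hn⟩] at h1
        · refine Eq.trans ?_ h1
          rw [Matrix.mulVec, dotProduct]
          refine Finset.sum_congr rfl fun j _ => ?_
          rw [mul_comm]
          congr 1
          exact (h.covariance_noise_self (0 - 1 - (n : ℤ)) a j).symm
        · intro k _ hk
          refine Finset.sum_eq_zero fun j _ => ?_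
          rcases lt_or_gt_of_ne (fun hkn : k.val = n => hk (Fin.ext hkn)) with hlt | hlt
          · rw [ih k hlt k.2 j, zero_mul]
          · have : cov[fun ω => ε (0 - 1 - (n : ℤ)) ω a,
                fun ω => lagVec p (fun s => y s ω) 0 (k, j); P] = 0 :=
              h.covariance_noise_of_lt (s := 0 - 1 - (k : ℤ)) (t := 0 - 1 - (n : ℤ)) (by omega) a j
            rw [this, mul_zero]
        · simp
      by_contra hne
      have hv : v ≠ 0 := fun hv => hne fun j => congrFun hv j
      have h2 := hSigma.dotProduct_mulVec_pos hv
      rw [show Sigma *ᵥ v = 0 from funext hzero, dotProduct_zero] at h2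
      exact lt_irrefl _ h2
  funext ⟨k, j⟩
  exact key k k.2 j

end Autoregression

/-! Convergence in probability to a constant -/

section TendstoInProb

variable {Ω : Type*} [MeasurableSpace Ω] {P : Measure Ω}

/-- Convergence in (outer) probability to a point of a topological space. -/
def TendstoInProb {E : Type*} [TopologicalSpace E] (P : Measure Ω) (f : ℕ → Ω → E) (m : E) : Prop :=
  ∀ U ∈ 𝓝 m, Tendsto (fun T : ℕ => P {ω | f T ω ∉ U}) atTop (𝓝 0)

theorem tendsto_measure_zero_of_subset {A B : ℕ → Set Ω} (h : ∀ᶠ T in atTop, A T ⊆ B T)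
    (hB : Tendsto (fun T => P (B T)) atTop (𝓝 0)) : Tendsto (fun T => P (A T)) atTop (𝓝 0) :=
  tendsto_of_tendsto_of_tendsto_of_le_of_le' tendsto_const_nhds hB
    (Eventually.of_forall fun _ => zero_le) (h.mono fun _ hT => measure_mono hT)

theorem tendsto_measure_zero_of_imp {a b : ℕ → Ω → Prop}
    (hb : Tendsto (fun T => P {ω | ¬ b T ω}) atTop (𝓝 0)) (h : ∀ T ω, b T ω → ¬ a T ω) :
    Tendsto (fun T => P {ω | a T ω}) atTop (𝓝 0) :=
  tendsto_measure_zero_of_subset (Eventually.of_forall fun T ω ha hn => h T ω hn ha) hb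

variable {E F : Type*} [TopologicalSpace E] [TopologicalSpace F] {f f' : ℕ → Ω → E} {m : E}

theorem TendstoInProb.comp (h : TendstoInProb P f m) {g : E → F} (hg : ContinuousAt g m) :
    TendstoInProb P (fun T ω => g (f T ω)) (g m) :=
  fun U hU => h (g ⁻¹' U) (hg hU)

theorem TendstoInProb.congr (h : TendstoInProb P f m) (hff' : ∀ᶠ T in atTop, f T = f' T) :
    TendstoInProb P f' m := fun U hU =>
  (h U hU).congr' (hff'.mono fun T hT => by rw [hT])

theorem TendstoInProb.prodMk {g : ℕ → Ω → F} {k : F} (hf : TendstoInProb P f m)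
    (hg : TendstoInProb P g k) : TendstoInProb P (fun T ω => (f T ω, g T ω)) (m, k) := by
  intro U hU
  obtain ⟨V, hV, W, hW, hVW⟩ := mem_nhds_prod_iff.1 hU
  have h := (hf V hV).add (hg W hW)
  rw [add_zero] at h
  refine tendsto_of_tendsto_of_tendsto_of_le_of_le tendsto_const_nhds h
    (fun _ => zero_le) fun T => ?_
  refine (measure_mono fun ω hω => ?_).trans (measure_union_le _ _)
  by_contra hn
  simp only [Set.mem_union, Set.mem_ofPred_eq, not_or, not_not] at hn
  exact hω (hVW ⟨hn.1, hn.2⟩)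

theorem TendstoInProb.pi {ι : Type*} [Finite ι] {E : ι → Type*} [∀ i, TopologicalSpace (E i)]
    {f : ℕ → Ω → ∀ i, E i} {m : ∀ i, E i}
    (h : ∀ i, TendstoInProb P (fun T ω => f T ω i) (m i)) : TendstoInProb P f m := by
  cases nonempty_fintype ι
  intro U hU
  rw [nhds_pi, Filter.mem_pi] at hU
  obtain ⟨I, -, V, hV, hVU⟩ := hU
  have hs := tendsto_finsetSum Finset.univ fun i (_ : i ∈ Finset.univ) => h i (V i) (hV i)
  rw [Finset.sum_const_zero] at hs
  refine tendsto_of_tendsto_of_tendsto_of_le_of_le tendsto_const_nhds hs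
    (fun _ => zero_le) fun T => ?_
  refine (measure_mono fun ω hω => ?_).trans (measure_iUnion_fintype_le P _)
  by_contra hn
  simp only [Set.mem_iUnion, Set.mem_ofPred_eq, not_exists, not_not] at hn
  exact hω (hVU fun i _ => hn i)

theorem MeanErgodic.tendstoInProb [IsProbabilityMeasure P] {Z : ℤ → Ω → ℝ}
    (hZ : ∀ t, Integrable (Z t) P) (h : MeanErgodic P Z) {m : ℝ} (hm : ∀ t, ∫ ω, Z t ω ∂P = m) :
    TendstoInProb P (fun T ω => (T : ℝ)⁻¹ * ∑ t ∈ Finset.Icc (1 : ℤ) (T : ℤ), Z t ω) m := by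
  intro U hU
  obtain ⟨δ, hδ, hball⟩ := Metric.mem_nhds_iff.1 hU
  have h1 : TendstoInMeasure P (centeredMean P Z) atTop 0 :=
    tendstoInMeasure_of_tendsto_eLpNorm one_ne_zero (fun T => (integrable_centeredMean hZ T).1)
      aestronglyMeasurable_zero (by simpa [MeanErgodic] using h)
  rw [tendstoInMeasure_iff_norm] at h1
  refine tendsto_measure_zero_of_subset ?_ (h1 δ hδ)
  filter_upwards [eventually_gt_atTop 0] with T hT ω hω
  by_contra hn
  refine hω (hball ?_)
  rw [Metric.mem_ball, Real.dist_eq]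
  rw [Set.mem_ofPred_eq, not_le] at hn
  refine lt_of_le_of_lt (le_of_eq ?_) hn
  have hT' : (T : ℝ) ≠ 0 := by exact_mod_cast hT.ne'
  simp only [centeredMean, hm, Pi.zero_apply, sub_zero, Pi.smul_apply, Finset.sum_apply,
    Pi.sub_apply, smul_eq_mul, Finset.sum_sub_distrib, Finset.sum_const, Int.card_Icc,
    nsmul_eq_mul, Real.norm_eq_abs]
  congr 1
  simp
  field_simp

end TendstoInProb

/-! Consistency of the sample moments -/

section SampleMoments

theorem sampleCov_apply {m n : Type*} {T : ℕ} (hT : 0 < T) (v : ℤ → m → ℝ) (w : ℤ → n → ℝ)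
    (i : m) (j : n) :
    sampleCov T v w i j = (T : ℝ)⁻¹ * ∑ t ∈ Finset.Icc (1 : ℤ) (T : ℤ), v t i * w t j -
      ((T : ℝ)⁻¹ * ∑ t ∈ Finset.Icc (1 : ℤ) (T : ℤ), v t i) *
        ((T : ℝ)⁻¹ * ∑ t ∈ Finset.Icc (1 : ℤ) (T : ℤ), w t j) := by
  have hT' : (T : ℝ) ≠ 0 := by exact_mod_cast hT.ne'
  have hv : sampleMean T v i = (T : ℝ)⁻¹ * ∑ t ∈ Finset.Icc (1 : ℤ) (T : ℤ), v t i := by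
    simp [sampleMean]
  have hw : sampleMean T w j = (T : ℝ)⁻¹ * ∑ t ∈ Finset.Icc (1 : ℤ) (T : ℤ), w t j := by
    simp [sampleMean]
  rw [← hv, ← hw, sampleCov, Matrix.smul_apply, Matrix.sum_apply, smul_eq_mul]
  simp only [Matrix.vecMulVec_apply, Pi.sub_apply, sub_mul, mul_sub, Finset.sum_sub_distrib,
    ← Finset.sum_mul, ← Finset.mul_sum, Finset.sum_const, Int.card_Icc, nsmul_eq_mul]
  rw [hv, hw]
  simp
  field_simp
  ring

variable {Ω : Type*} [MeasurableSpace Ω] {P : Measure Ω} [IsProbabilityMeasure P] {p q : ℕ}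
  {α : Fin q → ℝ} {β : Matrix (Fin q) (Fin p × Fin q) ℝ} {Sigma : Matrix (Fin q) (Fin q) ℝ}
  {ε y : ℤ → Ω → Fin q → ℝ}

/-- Each entry is an average of products minus a product of averages, and all three averages obey
the law of large numbers. -/
theorem tendstoInProb_sampleCov (h : IsIIDNoise P Sigma ε) {m n : Type*} [Finite m] [Finite n]
    {v : ℤ → Ω → m → ℝ} {w : ℤ → Ω → n → ℝ} (hv : ∀ i, IsMALimit P ε (fun t ω => v t ω i))
    (hw : ∀ j, IsMALimit P ε (fun t ω => w t ω j))
    (hv0 : ∀ t i, ∫ ω, v t ω i ∂P = ∫ ω, v 0 ω i ∂P)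
    (hw0 : ∀ t j, ∫ ω, w t ω j ∂P = ∫ ω, w 0 ω j ∂P)
    (hvw : ∀ t i j, ∫ ω, v t ω i * w t ω j ∂P = ∫ ω, v 0 ω i * w 0 ω j ∂P) :
    TendstoInProb P (fun T ω => sampleCov T (fun t => v t ω) (fun t => w t ω))
      (covMatrix P (v 0) (w 0)) := by
  refine TendstoInProb.pi fun i => TendstoInProb.pi fun j => ?_
  have h1 := ((hv i).meanErgodic_mul h (hw j)).tendstoInProb
    (fun t => ((hv i).memLp t).integrable_mul ((hw j).memLp t)) (fun t => hvw t i j)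
  have h2 := ((hv i).meanErgodic h).tendstoInProb
    (fun t => ((hv i).memLp t).integrable one_le_two) (fun t => hv0 t i)
  have h3 := ((hw j).meanErgodic h).tendstoInProb
    (fun t => ((hw j).memLp t).integrable one_le_two) (fun t => hw0 t j)
  have hc : Continuous fun x : ℝ × ℝ × ℝ => x.1 - x.2.1 * x.2.2 := by fun_prop
  have h4 := (h1.prodMk (h2.prodMk h3)).comp hc.continuousAt
  have h5 : covMatrix P (v 0) (w 0) i j = ∫ ω, v 0 ω i * w 0 ω j ∂P -
      (∫ ω, v 0 ω i ∂P) * ∫ ω, w 0 ω j ∂P :=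
    covariance_eq_sub ((hv i).memLp 0) ((hw j).memLp 0)
  rw [h5]
  refine h4.congr ?_
  filter_upwards [eventually_gt_atTop 0] with T hT
  funext ω
  exact (sampleCov_apply hT _ _ i j).symm

theorem IsStationaryVAR.isMALimit_lagVec (h : IsStationaryVAR P α β Sigma ε y)
    (l : Fin p × Fin q) : IsMALimit P ε (fun t ω => lagVec p (fun s => y s ω) t l) := by
  have := (h.isMALimit l.2).lag (l.1 + 1)
  convert this using 4
  simp only [lagVec]
  push_cast
  congr 1
  ring_nf

theorem IsStationaryVAR.tendstoInProb_sampleCov (h : IsStationaryVAR P α β Sigma ε y) :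
    TendstoInProb P (fun T ω => sampleCov T (fun t => y t ω) (fun t => y t ω))
      (covMatrix P (y 0) (y 0)) :=
  REVAR.tendstoInProb_sampleCov h.noise h.isMALimit h.isMALimit h.stationary.mean_eq
    h.stationary.mean_eq fun t i j => by simpa using h.stationary.integral_mul_eq 0 0 i j t

theorem IsStationaryVAR.tendstoInProb_sampleCov_lagVec_left
    (h : IsStationaryVAR P α β Sigma ε y) :
    TendstoInProb P (fun T ω => sampleCov T (lagVec p fun t => y t ω) (fun t => y t ω))
      (covMatrix P (fun ω => lagVec p (fun s => y s ω) 0) (y 0)) :=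
  REVAR.tendstoInProb_sampleCov h.noise (v := fun t ω => lagVec p (fun s => y s ω) t)
    h.isMALimit_lagVec h.isMALimit
    (fun t l => (h.stationary.mean_eq _ _).trans (h.stationary.mean_eq _ _).symm)
    h.stationary.mean_eq fun t l j => by
      have := h.stationary.integral_mul_eq (0 - 1 - (l.1 : ℤ)) 0 l.2 j t
      rw [show 0 - 1 - (l.1 : ℤ) + t = t - 1 - l.1 by ring, zero_add] at this
      exact this

theorem IsStationaryVAR.tendstoInProb_sampleCov_lagVec (h : IsStationaryVAR P α β Sigma ε y) :
    TendstoInProb P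
      (fun T ω => sampleCov T (lagVec p fun t => y t ω) (lagVec p fun t => y t ω))
      (lagCov P p y) :=
  REVAR.tendstoInProb_sampleCov h.noise (v := fun t ω => lagVec p (fun s => y s ω) t)
    (w := fun t ω => lagVec p (fun s => y s ω) t) h.isMALimit_lagVec h.isMALimit_lagVec
    (fun t l => (h.stationary.mean_eq _ _).trans (h.stationary.mean_eq _ _).symm)
    (fun t l => (h.stationary.mean_eq _ _).trans (h.stationary.mean_eq _ _).symm) fun t l k => by
      have := h.stationary.integral_mul_eq (0 - 1 - (l.1 : ℤ)) (0 - 1 - (k.1 : ℤ)) l.2 k.2 t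
      rw [show 0 - 1 - (l.1 : ℤ) + t = t - 1 - l.1 by ring,
        show 0 - 1 - (k.1 : ℤ) + t = t - 1 - k.1 by ring] at this
      exact this

/-- The residual covariance matrix is a consistent estimator of the noise covariance matrix. -/
theorem IsStationaryVAR.tendstoInProb_residCov (h : IsStationaryVAR P α β Sigma ε y)
    (hSigma : Sigma.PosDef) :
    TendstoInProb P (fun T ω => (residCov p T (fun t => y t ω),
      sampleCov T (fun t => y t ω) (fun t => y t ω)))
      (Sigma, Sigma + β * lagCov P p y * βᵀ) := by
  have hpd := h.posDef_lagCov hSigma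
  let f : Matrix (Fin q) (Fin q) ℝ × Matrix (Fin p × Fin q) (Fin q) ℝ ×
      Matrix (Fin p × Fin q) (Fin p × Fin q) ℝ → Matrix (Fin q) (Fin q) ℝ :=
    fun S => S.1 - S.2.1ᵀ * S.2.2⁻¹ * S.2.1
  have h1 := h.tendstoInProb_sampleCov.prodMk
    (h.tendstoInProb_sampleCov_lagVec_left.prodMk h.tendstoInProb_sampleCov_lagVec)
  have hinv : ContinuousAt (fun S : Matrix (Fin q) (Fin q) ℝ × Matrix (Fin p × Fin q) (Fin q) ℝ ×
      Matrix (Fin p × Fin q) (Fin p × Fin q) ℝ => S.2.2⁻¹) (covMatrix P (y 0) (y 0),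
      covMatrix P (fun ω => lagVec p (fun s => y s ω) 0) (y 0), lagCov P p y) := by
    have hsnd : ContinuousAt (fun S : Matrix (Fin q) (Fin q) ℝ ×
        Matrix (Fin p × Fin q) (Fin q) ℝ × Matrix (Fin p × Fin q) (Fin p × Fin q) ℝ => S.2.2)
        (covMatrix P (y 0) (y 0), covMatrix P (fun ω => lagVec p (fun s => y s ω) 0) (y 0),
          lagCov P p y) := by fun_prop
    exact ContinuousAt.comp (g := fun N : Matrix (Fin p × Fin q) (Fin p × Fin q) ℝ => N⁻¹)
      (continuousAt_matrix_inv hpd.det_pos.ne') hsnd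
  have hf : ContinuousAt f (covMatrix P (y 0) (y 0),
      covMatrix P (fun ω => lagVec p (fun s => y s ω) 0) (y 0), lagCov P p y) := by
    have hb : Continuous fun S : (Matrix (Fin q) (Fin q) ℝ × Matrix (Fin p × Fin q) (Fin q) ℝ ×
      Matrix (Fin p × Fin q) (Fin p × Fin q) ℝ) × Matrix (Fin p × Fin q) (Fin p × Fin q) ℝ =>
        S.1.1 - S.1.2.1ᵀ * S.2 * S.1.2.1 := by fun_prop
    exact hb.continuousAt.comp (continuousAt_id.prodMk hinv)
  have h2 := (h1.comp hf).prodMk h.tendstoInProb_sampleCov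
  -- With Γ = Γ_(p), the limit is Γ₀ - (βΓ)Γ⁻¹(Γβ') = Γ₀ - βΓβ' = Σ.
  have h3 : f (covMatrix P (y 0) (y 0), covMatrix P (fun ω => lagVec p (fun s => y s ω) 0) (y 0),
      lagCov P p y) = Sigma := by
    have ht : (lagCov P p y)ᵀ = lagCov P p y := by simpa using hpd.1.eq
    simp only [f]
    have hcancel : β * lagCov P p y * (lagCov P p y)⁻¹ * (lagCov P p y * βᵀ) =
        β * lagCov P p y * βᵀ := by
      rw [Matrix.mul_nonsing_inv_cancel_right _ _ hpd.det_pos.ne'.isUnit, ← Matrix.mul_assoc]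
    rw [h.covMatrix_lagVec, h.covMatrix_eq, Matrix.transpose_mul, Matrix.transpose_transpose, ht,
      hcancel, add_sub_cancel_right]
  rw [h3, h.covMatrix_eq] at h2
  exact h2

theorem isHermitian_residCov {q : ℕ} (p T : ℕ) (y : ℤ → Fin q → ℝ) :
    (residCov p T y).IsHermitian := by
  rw [Matrix.IsHermitian, Matrix.conjTranspose_eq_transpose_of_trivial, residCov]
  simp only [Matrix.transpose_sub, Matrix.transpose_mul, sampleCov_transpose,
    Matrix.transpose_nonsing_inv, Matrix.mul_assoc]

theorem isHermitian_sampleCov {n : Type*} (T : ℕ) (y : ℤ → n → ℝ) :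
    (sampleCov T y y).IsHermitian := by
  rw [Matrix.IsHermitian, Matrix.conjTranspose_eq_transpose_of_trivial, sampleCov_transpose]

end SampleMoments

/-! Consistency of the minimizers -/

section Consistency

variable {Ω : Type*} [MeasurableSpace Ω] {P : Measure Ω} [IsProbabilityMeasure P] {p q u : ℕ}
  {α : Fin q → ℝ} {β : Matrix (Fin q) (Fin p × Fin q) ℝ} {Sigma : Matrix (Fin q) (Fin q) ℝ}
  {ε y : ℤ → Ω → Fin q → ℝ}

/-- With probability tending to one the sample moments are positive definite and the sample
objective function is uniformly close to the population objective function. -/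
theorem IsStationaryVAR.tendsto_measure_not_close (h : IsStationaryVAR P α β Sigma ε y)
    (hSigma : Sigma.PosDef) {δ : ℝ} (hδ : 0 < δ) :
    Tendsto (fun T : ℕ => P {ω | ¬ ((residCov p T fun t => y t ω).PosDef ∧
      (sampleCov T (fun t => y t ω) fun t => y t ω).PosDef ∧
      ∀ D : Matrix (Fin q) (Fin u) ℝ, IsSemiorthogonal D →
        |sampleObjective p β.rank T (fun t => y t ω) D -
          popObjective Sigma (covMatrix P (y 0) (y 0)) D| < δ)}) atTop (𝓝 0) := by
  have hN := (h.posDef_lagCov hSigma).posSemidef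
  refine tendsto_measure_zero_of_imp (h.tendstoInProb_residCov hSigma _
    (eventually_abs_coreObjective_sub_lt (u := u) β hSigma hN hδ)) fun T ω hgood hω => hω ?_
  obtain ⟨h1, h2, h3⟩ := hgood (isHermitian_residCov p T _) (isHermitian_sampleCov T _)
  refine ⟨h1, h2, fun D hD => ?_⟩
  rw [h.covMatrix_eq]
  exact h3 D hD (isHermitian_compress T _ D)

theorem IsStationaryVAR.tendsto_measure_not_exists_isArgmin (h : IsStationaryVAR P α β Sigma ε y)
    (hSigma : Sigma.PosDef) (hne : ∃ D : Matrix (Fin q) (Fin u) ℝ, IsSemiorthogonal D) :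
    Tendsto (fun T : ℕ => P {ω | ¬ ∃ D : Matrix (Fin q) (Fin u) ℝ,
      IsArgmin (sampleObjective p β.rank T (fun t => y t ω)) D}) atTop (𝓝 0) :=
  tendsto_measure_zero_of_imp (h.tendsto_measure_not_close (u := u) hSigma one_pos)
    fun T _ hgood hω => hω (exists_isArgmin_sampleObjective p β.rank T hgood.1 hgood.2.1 hne)

/-- Minimizers lie with probability tending to one in every open set containing the semiorthogonal
matrices that span the envelope. -/
theorem IsStationaryVAR.tendsto_measure_notMem (h : IsStationaryVAR P α β Sigma ε y)
    (hSigma : Sigma.PosDef) (hu : Module.finrank ℝ (envelope Sigma (colSpan β)) = u)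
    {PhiHat : ℕ → Ω → Matrix (Fin q) (Fin u) ℝ}
    (hPhi : ∀ T ω, (∃ D : Matrix (Fin q) (Fin u) ℝ,
        IsArgmin (sampleObjective p β.rank T (fun t => y t ω)) D) →
      IsArgmin (sampleObjective p β.rank T (fun t => y t ω)) (PhiHat T ω))
    {U : Set (Matrix (Fin q) (Fin u) ℝ)} (hU : IsOpen U)
    (hmem : ∀ D, IsSemiorthogonal D → colSpan D = envelope Sigma (colSpan β) → D ∈ U) :
    Tendsto (fun T : ℕ => P {ω | ¬ (IsSemiorthogonal (PhiHat T ω) ∧ PhiHat T ω ∈ U)}) atTop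
      (𝓝 0) := by
  obtain ⟨D₀, hD₀, -⟩ := exists_semiorthogonal_colSpan_eq _ hu
  have hpd := h.posDef_lagCov hSigma
  obtain ⟨κ, hκ, hclose⟩ := exists_forall_isArgmin_mem (F := popObjective Sigma
    (Sigma + β * lagCov P p y * βᵀ)) (continuousOn_popObjective hSigma
      (posDef_add_mul_mul_transpose β hSigma hpd.posSemidef)) hU fun D hD =>
        hmem D hD.1 (colSpan_eq_envelope_of_isArgmin hSigma hpd hu hD)
  refine tendsto_measure_zero_of_imp (h.tendsto_measure_not_close (u := u) hSigma hκ)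
    fun T ω hgood hω => hω ?_
  have hmin := hPhi T ω (exists_isArgmin_sampleObjective p β.rank T hgood.1 hgood.2.1 ⟨D₀, hD₀⟩)
  have h3 := hgood.2.2
  rw [h.covMatrix_eq] at h3
  exact ⟨hmin.1, hclose _ h3 _ hmin⟩

end Consistency

end REVAR

/-! ### Uniform convergence and consistency of the envelope estimator -/

theorem mainTheorem6 {Ω : Type*} [MeasurableSpace Ω] (P : Measure Ω) [IsProbabilityMeasure P]
    {p q d u : ℕ} (α : Fin q → ℝ) (β : Matrix (Fin q) (Fin p × Fin q) ℝ)
    (Sigma : Matrix (Fin q) (Fin q) ℝ) (ε y : ℤ → Ω → Fin q → ℝ)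
    (hSigma : Sigma.PosDef) (hVAR : REVAR.IsStationaryVAR P α β Sigma ε y)
    (hd : β.rank = d)
    (hu : Module.finrank ℝ (REVAR.envelope Sigma (REVAR.colSpan β)) = u) :
    -- uniform convergence in probability of the objective function
    (∀ δ : ℝ, 0 < δ → Tendsto (fun T : ℕ => P {ω | ∃ D : Matrix (Fin q) (Fin u) ℝ,
        REVAR.IsSemiorthogonal D ∧
        δ ≤ |REVAR.sampleObjective p d T (fun t => y t ω) D -
          REVAR.popObjective Sigma (REVAR.covMatrix P (y 0) (y 0)) D|}) atTop (𝓝 0)) ∧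
    -- a minimizer of the sample objective function exists with probability tending to one
    Tendsto (fun T : ℕ => P {ω | ¬ ∃ D : Matrix (Fin q) (Fin u) ℝ,
        REVAR.IsArgmin (REVAR.sampleObjective p d T (fun t => y t ω)) D}) atTop (𝓝 0) ∧
    -- every choice of minimizers is consistent
    (∀ PhiHat : ℕ → Ω → Matrix (Fin q) (Fin u) ℝ,
      (∀ T ω, (∃ D : Matrix (Fin q) (Fin u) ℝ,
          REVAR.IsArgmin (REVAR.sampleObjective p d T (fun t => y t ω)) D) →
        REVAR.IsArgmin (REVAR.sampleObjective p d T (fun t => y t ω)) (PhiHat T ω)) →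
      -- as a basis, up to rotation
      (∀ Phi : Matrix (Fin q) (Fin u) ℝ, REVAR.IsSemiorthogonal Phi →
        REVAR.colSpan Phi = REVAR.envelope Sigma (REVAR.colSpan β) →
        ∀ δ : ℝ, 0 < δ → Tendsto (fun T : ℕ => P {ω | ¬ ∃ O : Matrix (Fin u) (Fin u) ℝ,
          O ∈ Matrix.orthogonalGroup (Fin u) ℝ ∧
          ∀ i j, |PhiHat T ω i j - (Phi * O) i j| < δ}) atTop (𝓝 0)) ∧
      -- as a subspace
      TendstoInMeasure P (fun T ω => (REVAR.colSpan (PhiHat T ω)).starProjection) atTop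
        (fun _ => (REVAR.envelope Sigma (REVAR.colSpan β)).starProjection)) := by
  subst hd
  -- An orthonormal basis of the envelope shows that semiorthogonal matrices of this size exist, so
  -- that minimizers can exist.
  obtain ⟨D₀, hD₀, -⟩ := REVAR.exists_semiorthogonal_colSpan_eq _ hu
  refine ⟨fun δ hδ => ?_, hVAR.tendsto_measure_not_exists_isArgmin hSigma ⟨D₀, hD₀⟩,
    fun PhiHat hPhi => ⟨fun Phi hPhi0 hspan δ hδ => ?_, fun e he => ?_⟩⟩
  · refine REVAR.tendsto_measure_zero_of_imp (hVAR.tendsto_measure_not_close (u := u) hSigma hδ)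
      fun T ω hgood hω => ?_
    obtain ⟨D, hD, hle⟩ := hω
    exact (hgood.2.2 D hD).not_ge hle
  · let V : Matrix (Fin u) (Fin u) ℝ → Set (Matrix (Fin q) (Fin u) ℝ) := fun O =>
      {X | ∀ i j, |X i j - (Phi * O) i j| < δ}
    have hV : ∀ O, IsOpen (V O) := fun O => by
      have : V O = ⋂ i, ⋂ j, {X | |X i j - (Phi * O) i j| < δ} := by
        ext X
        simp [V]
      rw [this]
      refine isOpen_iInter_of_finite fun i => isOpen_iInter_of_finite fun j =>
        isOpen_lt (by fun_prop) continuous_const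
    refine REVAR.tendsto_measure_zero_of_imp (hVAR.tendsto_measure_notMem hSigma hu hPhi
      (U := ⋃ O ∈ Matrix.orthogonalGroup (Fin u) ℝ, V O)
      (isOpen_biUnion fun O _ => hV O) fun D hD hDspan => ?_) fun T ω hgood hω => hω ?_
    rotate_left
    · obtain ⟨O, hO, hmem⟩ := Set.mem_iUnion₂.1 hgood.2
      exact ⟨O, hO, hmem⟩
    · obtain ⟨O, hO, rfl⟩ := REVAR.exists_orthogonal_mul_eq hD hPhi0 (hDspan.trans hspan.symm)
      exact Set.mem_iUnion₂.2 ⟨O, hO, fun i j => by simpa using hδ⟩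
  · have hc : Continuous fun X : Matrix (Fin q) (Fin u) ℝ =>
        Matrix.toEuclideanCLM (n := Fin q) (𝕜 := ℝ) (X * X.transpose) := by
      have h1 : Continuous fun X : Matrix (Fin q) (Fin u) ℝ => X * X.transpose := by fun_prop
      exact (LinearMap.continuous_of_finiteDimensional
        (Matrix.toEuclideanCLM (n := Fin q) (𝕜 := ℝ)).toAlgEquiv.toLinearMap).comp h1
    -- The open set is defined through the continuous map X ↦ XX'. This is identified with the
    -- projection onto the span when X is semiorthogonal, which is why that property of the
    -- estimator is part of the good event.
    refine REVAR.tendsto_measure_zero_of_imp (hVAR.tendsto_measure_notMem hSigma hu hPhi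
      (U := {X | edist (Matrix.toEuclideanCLM (n := Fin q) (𝕜 := ℝ) (X * X.transpose))
        (REVAR.envelope Sigma (REVAR.colSpan β)).starProjection < e})
      (isOpen_lt (hc.edist continuous_const) continuous_const) fun D hD hDspan => ?_)
      fun T ω hgood hω => ?_
    rotate_left
    · have h1 := hgood.2
      rw [Set.mem_ofPred_eq, ← REVAR.starProjection_colSpan hgood.1] at h1
      exact h1.not_ge hω
    · rw [Set.mem_ofPred_eq, ← REVAR.starProjection_colSpan hD, hDspan, edist_self]
      exact he
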